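/- \textbf{Setting.} Let $\Theta$ be a measurable space and let $\xi=(\xi_n)_{n\ge 0}$ be a sequence of i.i.d. $\Theta$-valued random variables with law $\tau$ on $\Theta^{\mathbb N}$. Let $\eta$ be a probability kernel from $\Theta$ to $\mathbb N\times\mathbb R\times\mathbb R\times\cdots$, where $\mathbb N=\{0,1,2,\dots\}$. Given $\xi$, let $X(u)=(N(u),L_1(u),L_2(u),\dots)$, indexed by the finite sequences $u$ of labels (the empty sequence $\emptyset$ included), be independent random vectors such that $X(u)$ has law $\eta(\xi_n)$ when $u$ has length $|u|=n$. Their law given $\xi$ is the quenched law $\mathbb P_\xi$, with expectation $\mathbb E_\xi$; the joint law of $\xi$ and $(X(u))_u$ is the annealed law $\mathbb P$, with expectation $\mathbb E$. The branching random walk starts with one particle $\emptyset$ at $S_\emptyset=0$; each particle $u$ of generation $n$ is replaced by the $N(u)$ particles $ui$, $1\le i\le N(u)$, of generation $n+1$, located at $S_{ui}=S_u+L_i(u)$. Let $\mathbb T_n$ be the set of particles of generation $n$. For $t\in\mathbb R$ put $$m_n(t)=\mathbb E_\xi\sum_{i=1}^{N(u)}e^{tL_i(u)}\in[0,\infty]\quad(|u|=n),\qquad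 P_n(t)=\prod_{i=0}^{n-1}m_i(t),\qquad W_n=\frac1{P_n(1)}\sum_{u\in\mathbb T_n}e^{S_u}.$$ \textbf{Theorem (Annealed $L^p$ convergence).} Assume that $m_0(1)=1$ almost surely and that $\mathbb P(W_1=1)<1$, and let $p>1$. Then $W_n$ converges $\mathbb P$-almost surely to a finite limit $W$, and $W_n\to W$ in $L^p(\mathbb P)$ (that is, $W$ and all $W_n$ belong to $L^p(\mathbb P)$ and $\mathbb E|W_n-W|^p\to0$) if and only if $$\mathbb E\,W_1^p<\infty\qquad\text{and}\qquad \mathbb E\,m_0(p)<1 .$$ -/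

import Mathlib

open MeasureTheory ProbabilityTheory Filter Topology
open scoped ENNReal

namespace BRWRE

/-- The state space of the reproduction vectors `(N, L₁, L₂, …)`. For `x : Mark` the number of
children is `x.1`, and `x.2 i` is the displacement of the `(i+1)`-st child, so that children carry
the labels `0, …, N - 1`. -/
abbrev Mark : Type := ℕ × (ℕ → ℝ)

/-- Realizations of the family `(X(u))` of reproduction vectors, indexed by all finite
sequences `u` (Ulam–Harris labels); the generation of `u` is `u.length`. -/
abbrev Marks : Type := List ℕ → Mark

variable {Θ : Type*} [MeasurableSpace Θ]

/-- The quenched law given the environment `ξ`: the vectors `X(u)` are independent, and `X(u)` has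
law `η (ξ n)` for `u` of length `n`. -/
noncomputable def quenchedMeasure (η : Kernel Θ Mark) [IsMarkovKernel η] (ξ : ℕ → Θ) :
    Measure Marks :=
  Measure.infinitePi fun u : List ℕ => η (ξ u.length)

theorem measurable_quenchedMeasure (η : Kernel Θ Mark) [IsMarkovKernel η] :
    Measurable (quenchedMeasure η) := by
  have hprob : ∀ ξ, IsProbabilityMeasure (quenchedMeasure η ξ) := fun ξ => by
    unfold quenchedMeasure; infer_instance
  refine Measurable.measure_of_isPiSystem_of_isProbabilityMeasure
    (S := squareCylinders fun _ : List ℕ => {s : Set Mark | MeasurableSet s})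
    generateFrom_squareCylinders.symm
    (isPiSystem_squareCylinders (fun _ => MeasurableSpace.isPiSystem_measurableSet) (by simp)) ?_
  rintro S ⟨s, t, ht, rfl⟩
  have ht' : ∀ u, MeasurableSet (t u) := fun u => ht u (Set.mem_univ u)
  have h : (fun ξ => quenchedMeasure η ξ ((s : Set (List ℕ)).pi t))
      = fun ξ : ℕ → Θ => ∏ u ∈ s, η (ξ u.length) (t u) := by
    funext ξ
    exact Measure.infinitePi_pi _ fun u _ => ht' u
  rw [h]
  exact Finset.measurable_prod s fun u _ =>
    (η.measurable_coe (ht' u)).comp (measurable_pi_apply _)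

/-- The quenched laws as a Markov kernel from environments to families of reproduction vectors. -/
noncomputable def quenched (η : Kernel Θ Mark) [IsMarkovKernel η] : Kernel (ℕ → Θ) Marks where
  toFun := quenchedMeasure η
  measurable' := measurable_quenchedMeasure η

instance (η : Kernel Θ Mark) [IsMarkovKernel η] : IsMarkovKernel (quenched η) :=
  ⟨fun ξ => by
    change IsProbabilityMeasure (Measure.infinitePi fun u : List ℕ => η (ξ u.length))
    infer_instance⟩

/-- The annealed law: the environment `ξ` has law `τ`, and given `ξ` the reproduction vectors
follow the quenched law. -/
noncomputable def annealed (τ : Measure (ℕ → Θ)) (η : Kernel Θ Mark) [IsMarkovKernel η] :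
    Measure ((ℕ → Θ) × Marks) :=
  τ ⊗ₘ quenched η

/-- The set of particles of generation `n`: the root `[]` is the particle of generation `0`, and
the children of `u` are `u ++ [i]` for `i < N(u)`. -/
def generation (x : Marks) : ℕ → Finset (List ℕ)
  | 0 => {[]}
  | n + 1 => (generation x n).biUnion fun u =>
      (Finset.range (x u).1).image fun i => u ++ [i]

/-- The position `S_u` of `u = u₁ ⋯ u_n`: the sum of the displacements of `u₁ ⋯ u_{k+1}` relative
to `u₁ ⋯ u_k`, over `k < n`. -/
def position (x : Marks) (u : List ℕ) : ℝ :=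
  ∑ k ∈ Finset.range u.length, (x (u.take k)).2 (u.getD k 0)

/-- `∑_{|u| = n} exp (t S_u)`, the Laplace transform of the counting measure of
generation `n`. -/
noncomputable def partitionFn (t : ℝ) (n : ℕ) (x : Marks) : ℝ :=
  ∑ u ∈ generation x n, Real.exp (t * position x u)

/-- `m_n(t) = 𝔼_ξ ∑_{i ≤ N} exp (t L_i)`, where `(N, L₁, L₂, …)` has law `η (ξ n)`; possibly
infinite. -/
noncomputable def m (η : Kernel Θ Mark) (n : ℕ) (t : ℝ) (ξ : ℕ → Θ) : ℝ≥0∞ :=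
  ∫⁻ y, ∑ i ∈ Finset.range y.1, ENNReal.ofReal (Real.exp (t * y.2 i)) ∂(η (ξ n))

/-- `P_n(t) = m_0(t) ⋯ m_{n-1}(t)`. -/
noncomputable def P (η : Kernel Θ Mark) (n : ℕ) (t : ℝ) (ξ : ℕ → Θ) : ℝ≥0∞ :=
  ∏ i ∈ Finset.range n, m η i t ξ

/-- `W_n(t) = P_n(t)⁻¹ ∑_{|u| = n} exp (t S_u)`, where `P_n(t)` is to be positive and finite. -/
noncomputable def Wt (η : Kernel Θ Mark) (t : ℝ) (n : ℕ) (ω : (ℕ → Θ) × Marks) : ℝ :=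
  partitionFn t n ω.2 / (P η n t ω.1).toReal

/-- `W_n = W_n(1)`. -/
noncomputable def W (η : Kernel Θ Mark) (n : ℕ) (ω : (ℕ → Θ) × Marks) : ℝ :=
  Wt η 1 n ω

/-- The pointwise limit `W` of `W_n` as `n → ∞` (an arbitrary number where there is no limit). -/
noncomputable def Wlim (η : Kernel Θ Mark) (ω : (ℕ → Θ) × Marks) : ℝ :=
  limUnder atTop fun n => W η n ω

/-- Convergence of `f n` to `g` in `L^p`: all of them lie in `L^p` and `‖f n - g‖_p → 0`. -/
def ConvergesInLp {Ω : Type*} [MeasurableSpace Ω] (μ : Measure Ω) (p : ℝ)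
    (f : ℕ → Ω → ℝ) (g : Ω → ℝ) : Prop :=
  (∀ n, MemLp (f n) (ENNReal.ofReal p) μ) ∧ MemLp g (ENNReal.ofReal p) μ ∧
    Tendsto (fun n => eLpNorm (fun ω => f n ω - g ω) (ENNReal.ofReal p) μ) atTop (𝓝 0)

end BRWRE

/-! Since `m η n 1 ξ = 1` for all `n` almost surely, `W_n` is almost surely the total mass `mass n`
of generation `n`, a nonnegative martingale of mean one, which converges almost surely. For `p > 1`
a martingale converges in `L^p` exactly when it is bounded there, so the question is whether `a_n =
𝔼 W_n^p` stays bounded. Write `b = 𝔼 m_0(p)`. Everything rests on the decomposition at the root,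
`W_{n+1} = ∑ i, exp (L_i) * w_i`: given `ξ`, the `w_i` are independent copies of `W_n` in the
shifted environment, independent of the root's reproduction vector. The shifted environment has law
`τ` and is independent of `ξ 0`, so products factorize on integrating over `ξ`.

Sufficiency. The power `p` of the sum is at most `r` times the sum of the powers plus `C` times
cross terms, for any `r > 1`. The diagonal contributes `r * b * a_n`. In the cross terms,
independence leaves only a moment of order `p - 1`, which is at most `K ^ (p - 1)` plus `K⁻¹` times
the moment of order `p`. Hence `a_{n+1} ≤ (r * b + C * a_1 / K) * a_n + C * a_1 * K ^ (p - 1)`, a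
contraction if `r` is close to `1` and `K` is large (`exists_quenchedMoment_succ_le`,
`annealedMoment_bounded`). The limit closes the martingale, and conditional Jensen gives convergence
in `L^p` (`tendsto_eLpNorm_of_martingale_bounded`).

Necessity. Superadditivity of `x ↦ x ^ p` gives `b * a_n ≤ a_{n+1}`, strictly when two subtrees
carry mass. If `b ≥ 1`, a Paley–Zygmund bound makes the gain uniform in `n`, so boundedness forces
at most one child almost surely (`markLaw_twoChildren_eq_zero`). Then `𝔼 W_1^p = b`, while
boundedness and `a_n ≥ 1` force `b ≤ 1`; the equality case of Jensen yields `W_1 = 1` almost surely,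
which is excluded (`lintegral_m_lt_one_of_bounded`). -/

namespace BRWRE

/-! ### Elementary inequalities for powers in `[0, ∞]` -/

section Inequalities

theorem rpow_eq_mul_rpow_sub_one {p : ℝ} (hp : 1 < p) (x : ℝ≥0∞) : x ^ p = x * x ^ (p - 1) := by
  have h := ENNReal.rpow_add_of_nonneg (x := x) 1 (p - 1) zero_le_one (by linarith)
  rwa [add_sub_cancel, ENNReal.rpow_one] at h

/-- Choose `t` with `(1 + t) ^ q = r` and compare `y` with `t * x`: either `x + y ≤ (1 + t) * x` or
`x ≤ t⁻¹ * y`. That `r` may be arbitrarily close to `1` is what later keeps `r * 𝔼 m_0(p)` below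
`1`. -/
theorem exists_rpow_add_le {q : ℝ} (hq : 0 < q) {r : ℝ≥0∞} (hr : 1 < r) (hr' : r ≠ ∞) :
    ∃ C : ℝ≥0∞, C ≠ ∞ ∧ ∀ x y : ℝ≥0∞, (x + y) ^ q ≤ r * x ^ q + C * y ^ q := by
  set s := r ^ q⁻¹ with hs
  have hs1 : 1 < s := by
    rw [hs]; exact ENNReal.one_lt_rpow hr (inv_pos.2 hq)
  have hsr : s ^ q = r := by
    rw [hs, ← ENNReal.rpow_mul, inv_mul_cancel₀ hq.ne', ENNReal.rpow_one]
  have hst : s ≠ ∞ := by rw [hs]; exact ENNReal.rpow_ne_top_of_nonneg (inv_pos.2 hq).le hr'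
  set t := s - 1 with ht
  have ht0 : t ≠ 0 := by rw [ht]; exact (tsub_pos_of_lt hs1).ne'
  have htt : t ≠ ∞ := by rw [ht]; exact ENNReal.sub_ne_top hst
  have h1t : 1 + t = s := by rw [ht]; exact add_tsub_cancel_of_le hs1.le
  refine ⟨(1 + t⁻¹) ^ q, ?_, fun x y => ?_⟩
  · exact ENNReal.rpow_ne_top_of_nonneg hq.le (by simp [ht0])
  · rcases le_total y (t * x) with h | h
    · calc (x + y) ^ q ≤ (s * x) ^ q := by
            rw [← h1t, add_mul, one_mul]; gcongr
        _ = r * x ^ q := by rw [ENNReal.mul_rpow_of_nonneg _ _ hq.le, hsr]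
        _ ≤ _ := le_self_add
    · have hx : x ≤ t⁻¹ * y := by
        rw [mul_comm, ← div_eq_mul_inv, ENNReal.le_div_iff_mul_le (.inl ht0) (.inl htt), mul_comm]
        exact h
      calc (x + y) ^ q ≤ ((1 + t⁻¹) * y) ^ q := by
            rw [add_mul, one_mul, add_comm]; gcongr
        _ = (1 + t⁻¹) ^ q * y ^ q := ENNReal.mul_rpow_of_nonneg _ _ hq.le
        _ ≤ _ := le_add_self

/-- Split at `y = K`. This trades a moment of order `p - 1` for an affine function of the moment of
order `p`, with a slope that a large `K` makes small. -/
theorem rpow_sub_one_le {p : ℝ} (hp : 1 < p) {K : ℝ≥0∞} (hK : K ≠ 0) (hK' : K ≠ ∞) (y : ℝ≥0∞) :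
    y ^ (p - 1) ≤ K ^ (p - 1) + K⁻¹ * y ^ p := by
  rcases le_total y K with h | h
  · exact (ENNReal.rpow_le_rpow h (by linarith)).trans le_self_add
  · refine le_trans ?_ le_add_self
    rw [mul_comm, ← div_eq_mul_inv, ENNReal.le_div_iff_mul_le (.inl hK) (.inl hK'),
      rpow_eq_mul_rpow_sub_one hp y, mul_comm]
    gcongr

theorem sum_rpow_le_rpow_sum {ι : Type*} (s : Finset ι) (x : ι → ℝ≥0∞) {p : ℝ} (hp : 1 < p) :
    ∑ i ∈ s, x i ^ p ≤ (∑ i ∈ s, x i) ^ p := by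
  classical
  induction s using Finset.induction_on with
  | empty => simp
  | insert a s ha ih =>
    rw [Finset.sum_insert ha, Finset.sum_insert ha]
    exact (add_le_add le_rfl ih).trans (ENNReal.add_rpow_le_rpow_add _ _ hp.le)

/-- Write the power as `∑ x i * (x i + rest) ^ (p - 1)` and split each factor by the two-term bound
with exponent `p - 1`. -/
theorem exists_rpow_sum_le {ι : Type*} [DecidableEq ι] {p : ℝ} (hp : 1 < p) {r : ℝ≥0∞} (hr : 1 < r)
    (hr' : r ≠ ∞) : ∃ C : ℝ≥0∞, C ≠ ∞ ∧ ∀ (s : Finset ι) (x : ι → ℝ≥0∞),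
      (∑ i ∈ s, x i) ^ p ≤
        r * ∑ i ∈ s, x i ^ p + C * ∑ i ∈ s, x i * (∑ j ∈ s.erase i, x j) ^ (p - 1) := by
  obtain ⟨C, hC, h⟩ := exists_rpow_add_le (q := p - 1) (by linarith) hr hr'
  refine ⟨C, hC, fun s x => ?_⟩
  rw [rpow_eq_mul_rpow_sub_one hp, Finset.sum_mul, Finset.mul_sum, Finset.mul_sum,
    ← Finset.sum_add_distrib]
  refine Finset.sum_le_sum fun i hi => ?_
  rw [← Finset.add_sum_erase s x hi]
  calc x i * (x i + ∑ j ∈ s.erase i, x j) ^ (p - 1)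
      ≤ x i * (r * x i ^ (p - 1) + C * (∑ j ∈ s.erase i, x j) ^ (p - 1)) := by
        gcongr; exact h _ _
    _ = _ := by rw [rpow_eq_mul_rpow_sub_one hp (x i)]; ring

/-- Expand `(x + y) ^ p = x * (x + y) ^ (p - 1) + y * (x + y) ^ (p - 1)`. If `x ≤ y`, then `x + y ≥
2 * x` in the first term, which gains `(2 ^ (p - 1) - 1) * x ^ p`. -/
theorem exists_rpow_add_ge {p : ℝ} (hp : 1 < p) {s : ℝ≥0∞} (hs : s ≠ 0) :
    ∃ c : ℝ≥0∞, c ≠ 0 ∧ ∀ x y : ℝ≥0∞, s ≤ x → s ≤ y → x ^ p + y ^ p + c ≤ (x + y) ^ p := by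
  have h2 : (1 : ℝ≥0∞) < 2 ^ (p - 1) := ENNReal.one_lt_rpow (by norm_num) (by linarith)
  set d : ℝ≥0∞ := 2 ^ (p - 1) - 1 with hd
  have hd0 : d ≠ 0 := by rw [hd]; exact (tsub_pos_of_lt h2).ne'
  have hd1 : 1 + d = 2 ^ (p - 1) := by rw [hd]; exact add_tsub_cancel_of_le h2.le
  have key : ∀ x y : ℝ≥0∞, s ≤ x → x ≤ y → x ^ p + y ^ p + d * s ^ p ≤ (x + y) ^ p := by
    intro x y hsx hxy
    have hp1 : 0 ≤ p - 1 := by linarith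
    calc x ^ p + y ^ p + d * s ^ p ≤ x ^ p + y ^ p + d * x ^ p := by gcongr
      _ = (1 + d) * x ^ p + y ^ p := by ring
      _ = x * (2 * x) ^ (p - 1) + y * y ^ (p - 1) := by
        rw [hd1, ENNReal.mul_rpow_of_nonneg _ _ hp1, rpow_eq_mul_rpow_sub_one hp x,
          rpow_eq_mul_rpow_sub_one hp y]; ring
      _ ≤ x * (x + y) ^ (p - 1) + y * (x + y) ^ (p - 1) := by
        gcongr
        · rw [two_mul]; gcongr
        · exact le_add_self
      _ = (x + y) ^ p := by rw [rpow_eq_mul_rpow_sub_one hp (x + y)]; ring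
  refine ⟨d * s ^ p, mul_ne_zero hd0 ?_, fun x y hx hy => ?_⟩
  · simp [ENNReal.rpow_eq_zero_iff, hs]; intro _; linarith
  · rcases le_total x y with h | h
    · exact key x y hx h
    · have := key y x hy h
      rwa [add_comm (y ^ p), add_comm y] at this

theorem exists_rpow_sum_ge {p : ℝ} (hp : 1 < p) {s : ℝ≥0∞} (hs : s ≠ 0) :
    ∃ c : ℝ≥0∞, c ≠ 0 ∧ ∀ (n : ℕ) (x : ℕ → ℝ≥0∞), 2 ≤ n → s ≤ x 0 → s ≤ x 1 →
      ∑ i ∈ Finset.range n, x i ^ p + c ≤ (∑ i ∈ Finset.range n, x i) ^ p := by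
  obtain ⟨c, hc, h⟩ := exists_rpow_add_ge hp hs
  refine ⟨c, hc, fun n x hn h0 h1 => ?_⟩
  obtain ⟨k, rfl⟩ := Nat.exists_eq_add_of_le hn
  rw [Finset.sum_range_add, Finset.sum_range_add, Finset.sum_range_succ, Finset.sum_range_succ,
    Finset.sum_range_succ, Finset.sum_range_succ]
  simp only [Finset.range_zero, Finset.sum_empty, zero_add]
  calc x 0 ^ p + x 1 ^ p + ∑ i ∈ Finset.range k, x (2 + i) ^ p + c
      = (x 0 ^ p + x 1 ^ p + c) + ∑ i ∈ Finset.range k, x (2 + i) ^ p := by ring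
    _ ≤ (x 0 + x 1) ^ p + (∑ i ∈ Finset.range k, x (2 + i)) ^ p :=
      add_le_add (h _ _ h0 h1) (sum_rpow_le_rpow_sum _ _ hp)
    _ ≤ _ := ENNReal.add_rpow_le_rpow_add _ _ hp.le

/-- Convexity of `x ↦ x ^ p`, with weights `a / ∑ a`. -/
theorem rpow_sum_mul_le {ι : Type*} (s : Finset ι) (a w : ι → ℝ≥0∞) {p : ℝ} (hp : 1 < p)
    (h0 : ∑ i ∈ s, a i ≠ 0) (ht : ∑ i ∈ s, a i ≠ ∞) :
    ((∑ i ∈ s, a i)⁻¹ * ∑ i ∈ s, a i * w i) ^ p ≤ (∑ i ∈ s, a i)⁻¹ * ∑ i ∈ s, a i * w i ^ p := by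
  have h := ENNReal.rpow_arith_mean_le_arith_mean_rpow s (fun i => (∑ i ∈ s, a i)⁻¹ * a i) w
    (by rw [← Finset.mul_sum, ENNReal.inv_mul_cancel h0 ht]) hp.le
  simpa [Finset.mul_sum, mul_assoc] using h

end Inequalities

/-! ### Moments of weighted sums of independent variables -/

section Moments

/-- In a cross term, `rpow_sub_one_le` and convexity turn the power `p - 1` of the remaining sum
into a sum of single terms `w j ^ p`. Each meets `w i` in a product of two factors, so pairwise
independence suffices. `C` depends on `p` and `r` only, which leaves `K` free to be chosen after it.
-/
theorem exists_lintegral_rpow_sum_le {p : ℝ} (hp : 1 < p) {r : ℝ≥0∞} (hr : 1 < r) (hr' : r ≠ ∞) :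
    ∃ C : ℝ≥0∞, C ≠ ∞ ∧ ∀ {Ω : Type} [MeasurableSpace Ω] {μ : Measure Ω} [IsProbabilityMeasure μ]
      (s : Finset ℕ) (a : ℕ → ℝ≥0∞) (_ : ∀ i, a i ≠ ∞) (w : ℕ → Ω → ℝ≥0∞) (_ : ∀ i, Measurable (w i))
      (_ : ∀ i j, i ≠ j → IndepFun (w i) (w j) μ) (_ : ∀ i, ∫⁻ ω, w i ω ∂μ ≤ 1) (α : ℝ≥0∞)
      (_ : ∀ i, ∫⁻ ω, w i ω ^ p ∂μ ≤ α) (K : ℝ≥0∞) (_ : K ≠ 0) (_ : K ≠ ∞),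
      ∫⁻ ω, (∑ i ∈ s, a i * w i ω) ^ p ∂μ ≤ r * (∑ i ∈ s, a i ^ p) * α +
        C * (∑ i ∈ s, a i) ^ p * (K ^ (p - 1) + K⁻¹ * α) := by
  obtain ⟨C, hC, h⟩ := exists_rpow_sum_le (ι := ℕ) hp hr hr'
  refine ⟨C, hC, fun {Ω} _ {μ} _ s a ha w hw hind h1 α hα K hK hK' => ?_⟩
  have hp0 : 0 ≤ p := by linarith
  have hq0 : 0 ≤ p - 1 := by linarith
  set A := ∑ i ∈ s, a i with hA
  have hAt : A ≠ ∞ := by rw [hA]; exact ENNReal.sum_ne_top.2 fun i _ => ha i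
  by_cases hA0 : A = 0
  · have h0 : ∀ i ∈ s, a i = 0 := by simpa [hA] using hA0
    have : ∀ ω, ∑ i ∈ s, a i * w i ω = 0 := fun ω =>
      Finset.sum_eq_zero fun i hi => by rw [h0 i hi, zero_mul]
    simp [this, ENNReal.zero_rpow_of_pos (zero_lt_one.trans hp)]
  have hcross : ∀ i ∈ s, ∀ ω, (∑ j ∈ s.erase i, a j * w j ω) ^ (p - 1) ≤
      A ^ (p - 1) * (K ^ (p - 1) + K⁻¹ * (A⁻¹ * ∑ j ∈ s.erase i, a j * w j ω ^ p)) := by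
    intro i hi ω
    -- Setting the `i`-th value to zero, instead of dropping the index, keeps the weights `a j / A`
    -- of total mass one for Jensen's inequality.
    let v : ℕ → ℝ≥0∞ := fun j => if j = i then 0 else w j ω
    have e1 : ∑ j ∈ s.erase i, a j * w j ω = A * (A⁻¹ * ∑ j ∈ s, a j * v j) := by
      rw [← mul_assoc, ENNReal.mul_inv_cancel hA0 hAt, one_mul, ← Finset.add_sum_erase s _ hi]
      simp only [v, if_true, mul_zero, zero_add]
      exact Finset.sum_congr rfl fun j hj => by rw [if_neg (Finset.ne_of_mem_erase hj)]
    have e2 : ∑ j ∈ s.erase i, a j * w j ω ^ p = ∑ j ∈ s, a j * v j ^ p := by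
      rw [← Finset.add_sum_erase s _ hi]
      simp only [v, if_true, ENNReal.zero_rpow_of_pos (zero_lt_one.trans hp), mul_zero, zero_add]
      exact Finset.sum_congr rfl fun j hj => by rw [if_neg (Finset.ne_of_mem_erase hj)]
    rw [e1, e2, ENNReal.mul_rpow_of_nonneg _ _ hq0]
    gcongr
    refine (rpow_sub_one_le hp hK hK' _).trans ?_
    gcongr
    exact rpow_sum_mul_le s a v hp hA0 hAt
  have hpair : ∀ i ∈ s, ∫⁻ ω, w i ω * (∑ j ∈ s.erase i, a j * w j ω) ^ (p - 1) ∂μ ≤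
      A ^ (p - 1) * (K ^ (p - 1) + K⁻¹ * α) := by
    intro i hi
    calc ∫⁻ ω, w i ω * (∑ j ∈ s.erase i, a j * w j ω) ^ (p - 1) ∂μ
        ≤ ∫⁻ ω, (A ^ (p - 1) * K ^ (p - 1)) * w i ω + (A ^ (p - 1) * K⁻¹ * A⁻¹) *
            ∑ j ∈ s.erase i, a j * (w i ω * w j ω ^ p) ∂μ := by
          refine lintegral_mono fun ω => ?_
          refine (mul_le_mul_right (hcross i hi ω) _).trans (le_of_eq ?_)
          simp only [Finset.mul_sum, mul_add]
          congr 1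
          · ring
          · exact Finset.sum_congr rfl fun j _ => by ring
      _ = (A ^ (p - 1) * K ^ (p - 1)) * ∫⁻ ω, w i ω ∂μ + (A ^ (p - 1) * K⁻¹ * A⁻¹) *
            ∑ j ∈ s.erase i, a j * ∫⁻ ω, w i ω * w j ω ^ p ∂μ := by
          rw [lintegral_add_left (by fun_prop), lintegral_const_mul _ (hw i),
            lintegral_const_mul _ (by fun_prop), lintegral_finsetSum _ (by fun_prop)]
          congr 2
          exact Finset.sum_congr rfl fun j _ => lintegral_const_mul _ (by fun_prop)
      _ ≤ (A ^ (p - 1) * K ^ (p - 1)) * 1 + (A ^ (p - 1) * K⁻¹ * A⁻¹) *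
            ∑ j ∈ s.erase i, a j * α := by
          gcongr with j hj
          · exact h1 i
          · have hij : i ≠ j := (Finset.ne_of_mem_erase hj).symm
            have hi2 : IndepFun (w i) (fun ω => w j ω ^ p) μ :=
              (hind i j hij).comp measurable_id (measurable_id.pow_const p)
            have := lintegral_mul_eq_lintegral_mul_lintegral_of_indepFun (hw i)
              ((hw j).pow_const p) hi2
            simp only [Pi.mul_apply] at this
            rw [this]
            calc _ ≤ 1 * α := mul_le_mul' (h1 i) (hα j)
              _ = α := one_mul _
      _ ≤ (A ^ (p - 1) * K ^ (p - 1)) * 1 + (A ^ (p - 1) * K⁻¹ * A⁻¹) * (A * α) := by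
          gcongr
          rw [← Finset.sum_mul]
          gcongr
          exact Finset.sum_le_sum_of_subset (Finset.erase_subset _ _)
      _ = A ^ (p - 1) * (K ^ (p - 1) + K⁻¹ * (A⁻¹ * A) * α) := by ring
      _ = _ := by rw [ENNReal.inv_mul_cancel hA0 hAt, mul_one]
  calc ∫⁻ ω, (∑ i ∈ s, a i * w i ω) ^ p ∂μ
      ≤ ∫⁻ ω, r * ∑ i ∈ s, a i ^ p * w i ω ^ p +
          C * ∑ i ∈ s, a i * (w i ω * (∑ j ∈ s.erase i, a j * w j ω) ^ (p - 1)) ∂μ := by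
        refine lintegral_mono fun ω => (h s _).trans (le_of_eq ?_)
        congr 2
        · exact Finset.sum_congr rfl fun i _ => ENNReal.mul_rpow_of_nonneg _ _ hp0
        · exact Finset.sum_congr rfl fun i _ => by ring
    _ = r * ∑ i ∈ s, a i ^ p * ∫⁻ ω, w i ω ^ p ∂μ +
          C * ∑ i ∈ s, a i * ∫⁻ ω, w i ω * (∑ j ∈ s.erase i, a j * w j ω) ^ (p - 1) ∂μ := by
        rw [lintegral_add_left (by fun_prop), lintegral_const_mul _ (by fun_prop),
          lintegral_const_mul _ (by fun_prop), lintegral_finsetSum _ (by fun_prop),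
          lintegral_finsetSum _ (by fun_prop)]
        congr 2
        · exact Finset.sum_congr rfl fun i _ => lintegral_const_mul _ (by fun_prop)
        · exact Finset.sum_congr rfl fun i _ => lintegral_const_mul _ (by fun_prop)
    _ ≤ r * ∑ i ∈ s, a i ^ p * α + C * ∑ i ∈ s, a i * (A ^ (p - 1) * (K ^ (p - 1) + K⁻¹ * α)) := by
        gcongr with i hi i hi
        · exact hα i
        · exact hpair i hi
    _ = _ := by
        rw [← Finset.sum_mul, ← Finset.sum_mul, ← hA, rpow_eq_mul_rpow_sub_one hp A]
        ring

end Moments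

/-- The marks of the subtree of descendants of the `(i+1)`-st child of the root. -/
def subtree (x : Marks) (i : ℕ) : Marks := fun v => x (i :: v)

/-- `∑_{i ≤ N} exp (t L_i)` for a single reproduction vector. -/
noncomputable def childSum (t : ℝ) (y : Mark) : ℝ≥0∞ :=
  ∑ i ∈ Finset.range y.1, ENNReal.ofReal (Real.exp (t * y.2 i))

/-- `∑_{|u| = n} exp (S_u)` with values in `ℝ≥0∞`. -/
noncomputable def mass (n : ℕ) (x : Marks) : ℝ≥0∞ :=
  ∑ u ∈ generation x n, ENNReal.ofReal (Real.exp (position x u))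

/-! ### Decomposition of the tree at the root and at the last generation -/

section Tree

theorem mem_generation_succ {x : Marks} {n : ℕ} {u : List ℕ} :
    u ∈ generation x (n + 1) ↔ ∃ v ∈ generation x n, ∃ i < (x v).1, v ++ [i] = u := by
  simp [generation]

theorem length_of_mem_generation {x : Marks} {n : ℕ} {u : List ℕ} (h : u ∈ generation x n) :
    u.length = n := by
  induction n generalizing u with
  | zero => simp [generation] at h; simp [h]
  | succ n ih =>
    obtain ⟨v, hv, i, -, rfl⟩ := mem_generation_succ.1 h
    simp [ih hv]

theorem mem_generation_succ_iff_root {x : Marks} {n : ℕ} {u : List ℕ} :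
    u ∈ generation x (n + 1) ↔
      ∃ i < (x []).1, ∃ v ∈ generation (subtree x i) n, i :: v = u := by
  induction n generalizing u with
  | zero => simp [generation]
  | succ n ih =>
    rw [mem_generation_succ]
    constructor
    · rintro ⟨v, hv, j, hj, rfl⟩
      obtain ⟨i, hi, w, hw, rfl⟩ := ih.1 hv
      exact ⟨i, hi, w ++ [j], mem_generation_succ.2 ⟨w, hw, j, hj, rfl⟩, rfl⟩
    · rintro ⟨i, hi, v, hv, rfl⟩
      obtain ⟨w, hw, j, hj, rfl⟩ := mem_generation_succ.1 hv
      exact ⟨i :: w, ih.2 ⟨i, hi, w, hw, rfl⟩, j, hj, rfl⟩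

theorem generation_succ_eq_root (x : Marks) (n : ℕ) :
    generation x (n + 1) = (Finset.range (x []).1).biUnion fun i =>
      (generation (subtree x i) n).image fun v => i :: v := by
  ext u
  simp [mem_generation_succ_iff_root]

theorem position_cons (x : Marks) (i : ℕ) (v : List ℕ) :
    position x (i :: v) = (x []).2 i + position (subtree x i) v := by
  simp [position, Finset.sum_range_succ', subtree, add_comm]

theorem position_append_singleton (x : Marks) (u : List ℕ) (i : ℕ) :
    position x (u ++ [i]) = position x u + (x u).2 i := by
  rw [position, List.length_append, List.length_singleton, Finset.sum_range_succ, position]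
  congr 1
  · refine Finset.sum_congr rfl fun k hk => ?_
    have hk' : k < u.length := Finset.mem_range.1 hk
    rw [List.take_append_of_le_length hk'.le, List.getD_append _ _ _ _ hk']
  · simp

theorem mass_zero (x : Marks) : mass 0 x = 1 := by
  simp [mass, generation, position]

theorem mass_succ (n : ℕ) (x : Marks) :
    mass (n + 1) x = ∑ i ∈ Finset.range (x []).1,
      ENNReal.ofReal (Real.exp ((x []).2 i)) * mass n (subtree x i) := by
  rw [mass, generation_succ_eq_root, Finset.sum_biUnion]
  · refine Finset.sum_congr rfl fun i _ => ?_
    rw [Finset.sum_image (by simp), mass, Finset.mul_sum]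
    refine Finset.sum_congr rfl fun v _ => ?_
    rw [position_cons, Real.exp_add, ENNReal.ofReal_mul (Real.exp_nonneg _)]
  · intro i _ j _ hij
    simp only [Function.onFun, Finset.disjoint_left, Finset.mem_image]
    rintro _ ⟨v, _, rfl⟩ ⟨w, _, h⟩
    exact hij (List.cons.inj h).1.symm

/-- Decomposing at the last generation serves the martingale property; the decomposition `mass_succ`
at the root serves the moment recursion. -/
theorem mass_succ_eq_sum_generation (n : ℕ) (x : Marks) :
    mass (n + 1) x = ∑ u ∈ generation x n,
      ENNReal.ofReal (Real.exp (position x u)) * childSum 1 (x u) := by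
  rw [mass, generation, Finset.sum_biUnion]
  · refine Finset.sum_congr rfl fun u _ => ?_
    rw [Finset.sum_image (by simp), childSum, Finset.mul_sum]
    refine Finset.sum_congr rfl fun v _ => ?_
    rw [position_append_singleton, Real.exp_add, ENNReal.ofReal_mul (Real.exp_nonneg _), one_mul]
  · intro u _ v _ huv
    simp only [Function.onFun, Finset.disjoint_left, Finset.mem_image]
    rintro _ ⟨i, _, rfl⟩ ⟨j, _, h⟩
    exact huv (List.append_inj' h rfl).1.symm

theorem mass_one (x : Marks) : mass 1 x = childSum 1 (x []) := by
  simp [mass_succ, mass_zero, childSum]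

theorem mass_ne_top (n : ℕ) (x : Marks) : mass n x ≠ ∞ :=
  ENNReal.sum_ne_top.2 fun _ _ => ENNReal.ofReal_ne_top

theorem partitionFn_one_eq (n : ℕ) (x : Marks) : partitionFn 1 n x = (mass n x).toReal := by
  rw [mass, ENNReal.toReal_sum fun _ _ => ENNReal.ofReal_ne_top, partitionFn]
  exact Finset.sum_congr rfl fun u _ => by rw [one_mul, ENNReal.toReal_ofReal (Real.exp_nonneg _)]

end Tree

/-! ### Measurability with respect to the history -/

section Measurability

theorem measurable_sum_range_comp {α : Type*} [MeasurableSpace α] {N : α → ℕ} (hN : Measurable N)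
    {g : ℕ → α → ℝ≥0∞} (hg : ∀ i, Measurable (g i)) :
    Measurable fun a => ∑ i ∈ Finset.range (N a), g i a := by
  have h : Measurable fun q : ℕ × α => ∑ i ∈ Finset.range q.1, g i q.2 :=
    measurable_from_prod_countable_right fun n => by
      simpa using Finset.measurable_sum _ fun i _ => hg i
  exact h.comp (hN.prodMk measurable_id)

theorem measurable_childSum (t : ℝ) : Measurable (childSum t) :=
  measurable_sum_range_comp (by fun_prop) fun i => by fun_prop

/-- The σ-algebra generated by the reproduction vectors of the generations before `n`. -/
@[reducible]
def history (n : ℕ) : MeasurableSpace Marks :=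
  ⨆ v ∈ {v : List ℕ | v.length < n}, MeasurableSpace.comap (fun x : Marks => x v) inferInstance

theorem history_le (n : ℕ) : history n ≤ (inferInstance : MeasurableSpace Marks) :=
  iSup₂_le fun v _ => (measurable_pi_apply v).comap_le

theorem history_mono : Monotone history := fun _ _ h =>
  biSup_mono fun _ hv => lt_of_lt_of_le hv h

theorem measurable_history_eval {n : ℕ} {v : List ℕ} (hv : v.length < n) :
    Measurable[history n] fun x : Marks => x v :=
  measurable_iff_comap_le.2 (le_iSup₂_of_le v hv le_rfl)

theorem measurableSet_mem_generation (n : ℕ) (u : List ℕ) :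
    MeasurableSet[history n] {x | u ∈ generation x n} := by
  induction n generalizing u with
  | zero => exact @MeasurableSet.const _ (history 0) (u ∈ ({[]} : Finset (List ℕ)))
  | succ n ih =>
    have h : {x | u ∈ generation x (n + 1)} = ⋃ v ∈ {v : List ℕ | v.length = n},
        ⋃ i ∈ {i : ℕ | v ++ [i] = u},
          {x | v ∈ generation x n} ∩ (fun x : Marks => x v) ⁻¹' {y | i < y.1} := by
      ext x
      simp only [Set.mem_ofPred_eq, mem_generation_succ, Set.mem_iUnion, Set.mem_inter_iff,
        Set.mem_preimage, exists_prop]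
      constructor
      · rintro ⟨v, hv, i, hi, h⟩
        exact ⟨v, length_of_mem_generation hv, i, h, hv, hi⟩
      · rintro ⟨v, -, i, h, hv, hi⟩
        exact ⟨v, hv, i, hi, h⟩
    rw [h]
    refine @MeasurableSet.biUnion _ _ (history (n + 1)) _ _ (Set.to_countable _) fun v hv => ?_
    refine @MeasurableSet.biUnion _ _ (history (n + 1)) _ _ (Set.to_countable _) fun i _ => ?_
    refine @MeasurableSet.inter _ (history (n + 1)) _ _ (history_mono n.le_succ _ (ih v)) ?_
    exact measurable_history_eval (Nat.lt_succ_of_le (le_of_eq hv))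
      (measurableSet_lt measurable_const measurable_fst)

theorem measurable_position (u : List ℕ) :
    Measurable[history u.length] fun x : Marks => position x u := by
  refine @Finset.measurable_sum _ _ _ _ _ _ (history u.length) _ _ fun k hk => ?_
  have hk' : k < u.length := Finset.mem_range.1 hk
  have h : Measurable fun y : Mark => y.2 (u.getD k 0) := by fun_prop
  exact h.comp (measurable_history_eval (by rw [List.length_take]; omega))

/-- `exp (S_u)` for a particle `u` of generation `n`, and `0` for a label that is not present. -/
noncomputable def particleMass (n : ℕ) (u : List ℕ) (x : Marks) : ℝ≥0∞ :=
  if u ∈ generation x n then ENNReal.ofReal (Real.exp (position x u)) else 0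

theorem measurable_particleMass (n : ℕ) (u : List ℕ) : Measurable[history n] (particleMass n u) := by
  by_cases hu : u.length = n
  · subst hu
    refine Measurable.ite (measurableSet_mem_generation _ u) ?_ measurable_const
    exact ENNReal.measurable_ofReal.comp (Real.measurable_exp.comp (measurable_position u))
  · have : particleMass n u = fun _ => 0 := by
      funext x
      exact if_neg fun h => hu (length_of_mem_generation h)
    rw [this]
    exact measurable_const

/-- A sum over the random set of particles becomes a series over all labels, which can be integrated
term by term. -/
theorem tsum_particleMass_mul (n : ℕ) (x : Marks) (f : List ℕ → ℝ≥0∞) :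
    ∑' u, particleMass n u x * f u =
      ∑ u ∈ generation x n, ENNReal.ofReal (Real.exp (position x u)) * f u := by
  rw [tsum_eq_sum (s := generation x n) fun u hu => by rw [particleMass, if_neg hu, zero_mul]]
  exact Finset.sum_congr rfl fun u hu => by rw [particleMass, if_pos hu]

theorem mass_eq_tsum (n : ℕ) (x : Marks) : mass n x = ∑' u, particleMass n u x := by
  simpa [mass] using (tsum_particleMass_mul n x fun _ => 1).symm

theorem mass_succ_eq_tsum (n : ℕ) (x : Marks) :
    mass (n + 1) x = ∑' u, particleMass n u x * childSum 1 (x u) := by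
  rw [mass_succ_eq_sum_generation, tsum_particleMass_mul]

theorem measurable_history_mass (n : ℕ) : Measurable[history n] (mass n) := by
  have h : mass n = fun x => ∑' u, particleMass n u x := funext fun x => mass_eq_tsum n x
  rw [h]
  simp_rw [ENNReal.tsum_eq_iSup_sum]
  exact .iSup fun s => s.measurable_fun_sum fun u _ => measurable_particleMass n u

theorem measurable_mass (n : ℕ) : Measurable (mass n) :=
  (measurable_history_mass n).mono (history_le n) le_rfl

end Measurability

/-! ### Independence of disjoint blocks of coordinates -/

section Independence

theorem indepFun_of_measurable_iSup_disjoint {Ω ι β γ : Type*} {E : ι → Type*} [mΩ : MeasurableSpace Ω]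
    [∀ i, MeasurableSpace (E i)] [MeasurableSpace β] [MeasurableSpace γ] {μ : Measure Ω}
    {X : ∀ i, Ω → E i} (hX : ∀ i, Measurable (X i)) (h : iIndepFun X μ) {S T : Set ι}
    (hST : Disjoint S T) {f : Ω → β} {g : Ω → γ}
    (hf : Measurable[⨆ i ∈ S, MeasurableSpace.comap (X i) inferInstance] f)
    (hg : Measurable[⨆ i ∈ T, MeasurableSpace.comap (X i) inferInstance] g) : IndepFun f g μ := by
  have h1 := indep_iSup_of_disjoint (fun i => (hX i).comap_le) h hST
  exact indep_of_indep_of_le_left (indep_of_indep_of_le_right h1 hg.comap_le) hf.comap_le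

theorem measurable_iSup_comap {Ω ι : Type*} {E : ι → Type*} [∀ i, MeasurableSpace (E i)]
    {X : ∀ i, Ω → E i} {S : Set ι} {i : ι} (hi : i ∈ S) :
    Measurable[⨆ i ∈ S, MeasurableSpace.comap (X i) inferInstance] (X i) :=
  measurable_iff_comap_le.2 (le_iSup₂_of_le i hi le_rfl)

end Independence

/-! ### The shifted environment -/

section Environment

variable {Θ : Type*} [MeasurableSpace Θ]

/-- The environment seen from the first generation on. -/
def shift (ξ : ℕ → Θ) : ℕ → Θ := fun n => ξ (n + 1)

theorem measurable_shift : Measurable (shift : (ℕ → Θ) → ℕ → Θ) := by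
  unfold shift; fun_prop

variable {τ : Measure (ℕ → Θ)}

theorem indepFun_zero_shift (h_indep : iIndepFun (fun (n : ℕ) (ξ : ℕ → Θ) => ξ n) τ) :
    IndepFun (fun ξ : ℕ → Θ => ξ 0) shift τ := by
  refine indepFun_of_measurable_iSup_disjoint (fun i => measurable_pi_apply i) h_indep
    (S := {0}) (T := {0}ᶜ) disjoint_compl_right (measurable_iSup_comap (X := fun (n : ℕ) (ξ : ℕ → Θ) => ξ n) (Set.mem_singleton _)) ?_
  exact @measurable_pi_lambda _ _ _ (_) _ _ fun n =>
    measurable_iSup_comap (X := fun (n : ℕ) (ξ : ℕ → Θ) => ξ n) (Nat.succ_ne_zero n)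

theorem map_shift (h_indep : iIndepFun (fun (n : ℕ) (ξ : ℕ → Θ) => ξ n) τ)
    (h_ident : ∀ n : ℕ, IdentDistrib (fun ξ : ℕ → Θ => ξ n) (fun ξ : ℕ → Θ => ξ 0) τ τ) :
    τ.map shift = τ := by
  have h1 := h_indep.map_fun_eq_infinitePi_map fun n => measurable_pi_apply n
  have h2 := (h_indep.precomp Nat.succ_injective).map_fun_eq_infinitePi_map
    fun n => measurable_pi_apply (n + 1)
  have h3 : τ.map (fun (ξ : ℕ → Θ) n => ξ n) = τ := Measure.map_id
  have h4 : ∀ n : ℕ, τ.map (fun ξ : ℕ → Θ => ξ n) = τ.map fun ξ => ξ 0 := fun n => (h_ident n).map_eq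
  calc τ.map shift = Measure.infinitePi fun n => τ.map fun ξ : ℕ → Θ => ξ (n + 1) := h2
    _ = Measure.infinitePi fun n => τ.map fun ξ : ℕ → Θ => ξ n := by simp_rw [h4]
    _ = τ := by rw [← h1, h3]

theorem lintegral_zero_mul_shift (h_indep : iIndepFun (fun (n : ℕ) (ξ : ℕ → Θ) => ξ n) τ)
    (h_ident : ∀ n : ℕ, IdentDistrib (fun ξ : ℕ → Θ => ξ n) (fun ξ : ℕ → Θ => ξ 0) τ τ)
    {f : Θ → ℝ≥0∞} (hf : Measurable f) {g : (ℕ → Θ) → ℝ≥0∞} (hg : Measurable g) :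
    ∫⁻ ξ, f (ξ 0) * g (shift ξ) ∂τ = (∫⁻ ξ, f (ξ 0) ∂τ) * ∫⁻ ξ, g ξ ∂τ := by
  have h := lintegral_mul_eq_lintegral_mul_lintegral_of_indepFun
    (hf.comp (measurable_pi_apply 0)) (hg.comp measurable_shift)
    ((indepFun_zero_shift h_indep).comp hf hg)
  have h2 : ∫⁻ ξ, g ξ ∂τ = ∫⁻ ξ, g (shift ξ) ∂τ := by
    conv_lhs => rw [← map_shift h_indep h_ident]
    exact lintegral_map hg measurable_shift
  rw [h2]
  exact h

end Environment

/-! ### The branching property and the martingale property under the quenched law -/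

section Quenched

variable {Θ : Type*} [MeasurableSpace Θ] (η : Kernel Θ Mark) [IsMarkovKernel η]

instance (ξ : ℕ → Θ) : IsProbabilityMeasure (quenchedMeasure η ξ) := by
  unfold quenchedMeasure; infer_instance

theorem quenched_apply (ξ : ℕ → Θ) : quenched η ξ = quenchedMeasure η ξ := rfl

theorem iIndepFun_quenched (ξ : ℕ → Θ) :
    iIndepFun (fun (u : List ℕ) (x : Marks) => x u) (quenchedMeasure η ξ) :=
  iIndepFun_infinitePi (X := fun _ y => y) fun _ => measurable_id

theorem map_eval_quenched (ξ : ℕ → Θ) (u : List ℕ) :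
    (quenchedMeasure η ξ).map (fun x => x u) = η (ξ u.length) :=
  Measure.infinitePi_map_eval _ u

theorem lintegral_eval_quenched (ξ : ℕ → Θ) (u : List ℕ) {f : Mark → ℝ≥0∞} (hf : Measurable f) :
    ∫⁻ x, f (x u) ∂(quenchedMeasure η ξ) = ∫⁻ y, f y ∂(η (ξ u.length)) := by
  rw [← map_eval_quenched, lintegral_map hf (measurable_pi_apply u)]

theorem measurable_subtree : Measurable (subtree : Marks → ℕ → Marks) := by
  unfold subtree; fun_prop

/-- The labels `i :: v` are distinct for distinct pairs `(i, v)`, and their length is `v.length +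
1`. The marks there form a product measure over pairs in the shifted environment, and currying
groups them into i.i.d. trees. -/
theorem map_subtree_quenched (ξ : ℕ → Θ) :
    (quenchedMeasure η ξ).map subtree =
      Measure.infinitePi fun _ : ℕ => quenchedMeasure η (shift ξ) := by
  have hinj : Function.Injective fun q : ℕ × List ℕ => q.1 :: q.2 := by
    rintro ⟨i, v⟩ ⟨j, w⟩ h
    simpa using h
  have h1 := Measure.map_infinitePi_infinitePi_of_inj (P := fun u : List ℕ => η (ξ u.length)) hinj
  have h2 := Measure.infinitePi_map_curry (fun (_ : ℕ) (v : List ℕ) => η (shift ξ v.length))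
  have h3 : (subtree : Marks → ℕ → Marks) = (MeasurableEquiv.curry ℕ (List ℕ) Mark) ∘
      fun x (q : ℕ × List ℕ) => x (q.1 :: q.2) := rfl
  rw [h3, ← Measure.map_map (MeasurableEquiv.measurable _) (by fun_prop), quenchedMeasure, h1]
  exact h2

theorem indepFun_root_subtree (ξ : ℕ → Θ) :
    IndepFun (fun x : Marks => x []) subtree (quenchedMeasure η ξ) := by
  refine indepFun_of_measurable_iSup_disjoint (fun i => measurable_pi_apply i)
    (iIndepFun_quenched η ξ) (S := {[]}) (T := {[]}ᶜ) disjoint_compl_right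
    (measurable_iSup_comap (X := fun (u : List ℕ) (x : Marks) => x u) (Set.mem_singleton _)) ?_
  exact @measurable_pi_lambda _ _ _ (_) _ _ fun i => @measurable_pi_lambda _ _ _ (_) _ _ fun v =>
    measurable_iSup_comap (X := fun (u : List ℕ) (x : Marks) => x u) (List.cons_ne_nil i v)

theorem lintegral_root_subtree (ξ : ℕ → Θ) {F : Mark × (ℕ → Marks) → ℝ≥0∞} (hF : Measurable F) :
    ∫⁻ x, F (x [], subtree x) ∂(quenchedMeasure η ξ) =
      ∫⁻ y, ∫⁻ z, F (y, z) ∂(Measure.infinitePi fun _ : ℕ => quenchedMeasure η (shift ξ))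
        ∂(η (ξ 0)) := by
  have h := (indepFun_iff_map_prod_eq_prod_map_map (measurable_pi_apply []).aemeasurable
    measurable_subtree.aemeasurable).1 (indepFun_root_subtree η ξ)
  rw [map_subtree_quenched, map_eval_quenched] at h
  rw [← lintegral_prod _ hF.aemeasurable]
  have h0 : (([] : List ℕ).length) = 0 := rfl
  rw [h0] at h
  rw [← h, lintegral_map hF ((measurable_pi_apply []).prodMk measurable_subtree)]

theorem lintegral_mul_childSum_of_history (ξ : ℕ → Θ) {u : List ℕ} {H : Marks → ℝ≥0∞}
    (hH : Measurable[history u.length] H) :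
    ∫⁻ x, H x * childSum 1 (x u) ∂(quenchedMeasure η ξ) =
      (∫⁻ x, H x ∂(quenchedMeasure η ξ)) * m η u.length 1 ξ := by
  have hind : IndepFun H (fun x : Marks => x u) (quenchedMeasure η ξ) :=
    indepFun_of_measurable_iSup_disjoint (fun i => measurable_pi_apply i)
      (iIndepFun_quenched η ξ) (S := {v | v.length < u.length}) (T := {u})
      (by simp) hH
      (measurable_iSup_comap (X := fun (u : List ℕ) (x : Marks) => x u) (Set.mem_singleton _))
  have h := lintegral_mul_eq_lintegral_mul_lintegral_of_indepFun (hH.mono (history_le _) le_rfl)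
    ((measurable_childSum 1).comp (measurable_pi_apply u))
    (hind.comp measurable_id (measurable_childSum 1))
  have h2 : ∫⁻ x, childSum 1 (x u) ∂(quenchedMeasure η ξ) = m η u.length 1 ξ :=
    lintegral_eval_quenched η ξ u (measurable_childSum 1)
  rw [← h2]
  exact h

/-- The quenched martingale property, tested against a nonnegative function of the past. -/
theorem lintegral_mul_mass_succ (ξ : ℕ → Θ) (n : ℕ) {H : Marks → ℝ≥0∞}
    (hH : Measurable[history n] H) :
    ∫⁻ x, H x * mass (n + 1) x ∂(quenchedMeasure η ξ) =
      (∫⁻ x, H x * mass n x ∂(quenchedMeasure η ξ)) * m η n 1 ξ := by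
  have hm : ∀ u, Measurable[history n] fun x => H x * particleMass n u x := fun u =>
    hH.mul (measurable_particleMass n u)
  have hm' : ∀ u, Measurable fun x => H x * particleMass n u x := fun u =>
    (hm u).mono (history_le n) le_rfl
  simp_rw [mass_succ_eq_tsum, mass_eq_tsum, ← ENNReal.tsum_mul_left, ← mul_assoc]
  have hc : ∀ u, Measurable fun x : Marks => childSum 1 (x u) := fun u =>
    (measurable_childSum 1).comp (measurable_pi_apply u)
  have hmc : ∀ u, Measurable fun x => H x * particleMass n u x * childSum 1 (x u) := fun u =>
    (hm' u).mul (hc u)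
  rw [lintegral_tsum fun u => (hmc u).aemeasurable,
    lintegral_tsum fun u => (hm' u).aemeasurable, ← ENNReal.tsum_mul_right]
  refine tsum_congr fun u => ?_
  by_cases hu : u.length = n
  · subst hu
    exact lintegral_mul_childSum_of_history η ξ (hm u)
  · have h0 : ∀ x, particleMass n u x = 0 := fun x =>
      if_neg fun h => hu (length_of_mem_generation h)
    simp [h0]

theorem lintegral_mass (ξ : ℕ → Θ) (n : ℕ) :
    ∫⁻ x, mass n x ∂(quenchedMeasure η ξ) = P η n 1 ξ := by
  induction n with
  | zero => simp [mass_zero, P]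
  | succ n ih =>
    have h := lintegral_mul_mass_succ η ξ n (H := fun _ => 1) measurable_const
    simp only [one_mul] at h
    rw [h, ih, P, P, Finset.prod_range_succ]

end Quenched

/-! ### Recursive bounds for the quenched moments -/

section RootRecursion

variable {Θ : Type*} [MeasurableSpace Θ]

theorem m_zero_eq (η : Kernel Θ Mark) (p : ℝ) (ξ : ℕ → Θ) :
    m η 0 p ξ = ∫⁻ y, childSum p y ∂(η (ξ 0)) := rfl

variable (η : Kernel Θ Mark) [IsMarkovKernel η]

/-- `𝔼_ξ (∑_{|u| = n} exp (S_u))^p`. -/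
noncomputable def quenchedMoment (p : ℝ) (n : ℕ) (ξ : ℕ → Θ) : ℝ≥0∞ :=
  ∫⁻ x, mass n x ^ p ∂(quenchedMeasure η ξ)

theorem measurable_quenchedMoment (p : ℝ) (n : ℕ) : Measurable (quenchedMoment η p n) :=
  ((measurable_mass n).pow_const p).lintegral_kernel (κ := quenched η)

theorem ofReal_exp_mul (p t : ℝ) :
    ENNReal.ofReal (Real.exp (p * t)) = ENNReal.ofReal (Real.exp t) ^ p := by
  rw [ENNReal.ofReal_rpow_of_pos (Real.exp_pos t), ← Real.exp_mul, mul_comm]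

theorem childSum_eq (p : ℝ) (y : Mark) :
    childSum p y = ∑ i ∈ Finset.range y.1, ENNReal.ofReal (Real.exp (y.2 i)) ^ p := by
  simp_rw [childSum, ofReal_exp_mul]

theorem childSum_one_eq (y : Mark) :
    childSum 1 y = ∑ i ∈ Finset.range y.1, ENNReal.ofReal (Real.exp (y.2 i)) := by
  simp_rw [childSum, one_mul]

theorem quenchedMoment_one (p : ℝ) (ξ : ℕ → Θ) :
    quenchedMoment η p 1 ξ = ∫⁻ y, childSum 1 y ^ p ∂(η (ξ 0)) := by
  simp_rw [quenchedMoment, mass_one]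
  exact lintegral_eval_quenched η ξ [] ((measurable_childSum 1).pow_const p)

theorem quenchedMoment_zero (p : ℝ) (ξ : ℕ → Θ) : quenchedMoment η p 0 ξ = 1 := by
  simp [quenchedMoment, mass_zero]

/-- The `p`-th power of `∑_{i ≤ N} exp (L_i) w_i`, where `w_i` is the mass of generation `n` of the
`(i+1)`-st tree of a family. -/
noncomputable def rootRecursion (p : ℝ) (n : ℕ) (q : Mark × (ℕ → Marks)) : ℝ≥0∞ :=
  (∑ i ∈ Finset.range q.1.1, ENNReal.ofReal (Real.exp (q.1.2 i)) * mass n (q.2 i)) ^ p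

theorem measurable_rootRecursion (p : ℝ) (n : ℕ) : Measurable (rootRecursion p n) := by
  refine (measurable_sum_range_comp (by fun_prop) fun i => Measurable.mul (by fun_prop) ?_).pow_const p
  exact (measurable_mass n).comp (by fun_prop)

theorem quenchedMoment_succ (p : ℝ) (n : ℕ) (ξ : ℕ → Θ) :
    quenchedMoment η p (n + 1) ξ = ∫⁻ y, ∫⁻ z, rootRecursion p n (y, z)
      ∂(Measure.infinitePi fun _ : ℕ => quenchedMeasure η (shift ξ)) ∂(η (ξ 0)) := by
  rw [← lintegral_root_subtree η ξ (measurable_rootRecursion p n)]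
  simp_rw [quenchedMoment, mass_succ, rootRecursion]

theorem lintegral_eval_infinitePi (Q : Measure Marks) [IsProbabilityMeasure Q] (i : ℕ)
    {f : Marks → ℝ≥0∞} (hf : Measurable f) :
    ∫⁻ z, f (z i) ∂(Measure.infinitePi fun _ : ℕ => Q) = ∫⁻ x, f x ∂Q := by
  have h := Measure.infinitePi_map_eval (fun _ : ℕ => Q) i
  conv_rhs => rw [← h]
  exact (lintegral_map hf (measurable_pi_apply i)).symm

theorem indepFun_eval_infinitePi (Q : Measure Marks) [IsProbabilityMeasure Q] {i j : ℕ} (hij : i ≠ j)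
    {f g : Marks → ℝ≥0∞} (hf : Measurable f) (hg : Measurable g) :
    IndepFun (fun z => f (z i)) (fun z => g (z j)) (Measure.infinitePi fun _ : ℕ => Q) := by
  have h : iIndepFun (fun (k : ℕ) (z : ℕ → Marks) => z k) (Measure.infinitePi fun _ : ℕ => Q) :=
    iIndepFun_infinitePi (X := fun _ y => y) fun _ => measurable_id
  exact (h.indepFun hij).comp hf hg

/-- Apply the moment bound for fixed root mark, with weights `exp (L_i)`, and integrate over the
mark: the sum of the `p`-th powers of the weights gives `m η 0 p ξ`, and the `p`-th power of their
sum gives the first-generation moment. -/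
theorem exists_quenchedMoment_succ_le {p : ℝ} (hp : 1 < p) {r : ℝ≥0∞} (hr : 1 < r) (hr' : r ≠ ∞) :
    ∃ C : ℝ≥0∞, C ≠ ∞ ∧ ∀ (n : ℕ) (ξ : ℕ → Θ) (_ : P η n 1 (shift ξ) ≤ 1) (K : ℝ≥0∞) (_ : K ≠ 0)
      (_ : K ≠ ∞), quenchedMoment η p (n + 1) ξ ≤ r * m η 0 p ξ * quenchedMoment η p n (shift ξ) +
        C * quenchedMoment η p 1 ξ * (K ^ (p - 1) + K⁻¹ * quenchedMoment η p n (shift ξ)) := by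
  obtain ⟨C, hC, h⟩ := exists_lintegral_rpow_sum_le hp hr hr'
  refine ⟨C, hC, fun n ξ hP K hK hK' => ?_⟩
  have hw : ∀ i : ℕ, Measurable fun z : ℕ → Marks => mass n (z i) := fun i =>
    (measurable_mass n).comp (measurable_pi_apply i)
  rw [quenchedMoment_succ, quenchedMoment_one, m_zero_eq]
  set α := quenchedMoment η p n (shift ξ) with hα
  calc _ ≤ ∫⁻ y, r * α * childSum p y + C * (K ^ (p - 1) + K⁻¹ * α) * childSum 1 y ^ p ∂(η (ξ 0)) := by
        refine lintegral_mono fun y => ?_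
        refine (h (μ := Measure.infinitePi fun _ : ℕ => quenchedMeasure η (shift ξ))
          (Finset.range y.1) (fun i => ENNReal.ofReal (Real.exp (y.2 i)))
          (fun i => ENNReal.ofReal_ne_top) (fun i z => mass n (z i)) hw
          (fun i j hij => indepFun_eval_infinitePi _ hij (measurable_mass n) (measurable_mass n))
          (fun i => ?_) α (fun i => ?_) K hK hK').trans (le_of_eq ?_)
        · rw [lintegral_eval_infinitePi _ i (measurable_mass n), lintegral_mass]
          exact hP
        · exact (lintegral_eval_infinitePi _ i ((measurable_mass n).pow_const p)).le
        · rw [childSum_eq, childSum_one_eq]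
          ring
    _ = _ := by
        rw [lintegral_add_left ((measurable_childSum p).const_mul _),
          lintegral_const_mul _ (measurable_childSum p),
          lintegral_const_mul _ ((measurable_childSum 1).pow_const p)]
        ring

/-- The reproduction vectors with at least two children, the first two of which carry mass at
least `δ`. -/
def twoChildren (δ : ℝ≥0∞) : Set Mark :=
  {y | 2 ≤ y.1 ∧ δ ≤ ENNReal.ofReal (Real.exp (y.2 0)) ∧ δ ≤ ENNReal.ofReal (Real.exp (y.2 1))}

theorem measurableSet_twoChildren (δ : ℝ≥0∞) : MeasurableSet (twoChildren δ) := by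
  have h : twoChildren δ = {y | 2 ≤ y.1} ∩ ({y | δ ≤ ENNReal.ofReal (Real.exp (y.2 0))} ∩
      {y | δ ≤ ENNReal.ofReal (Real.exp (y.2 1))}) := rfl
  rw [h]
  refine (measurableSet_le measurable_const measurable_fst).inter
    ((measurableSet_le measurable_const ?_).inter (measurableSet_le measurable_const ?_)) <;> fun_prop

theorem lintegral_mass_rpow_sum (ξ : ℕ → Θ) (p : ℝ) (n : ℕ) (hp : 0 ≤ p) (y : Mark) :
    ∫⁻ z, ∑ i ∈ Finset.range y.1, (ENNReal.ofReal (Real.exp (y.2 i)) * mass n (z i)) ^ p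
      ∂(Measure.infinitePi fun _ : ℕ => quenchedMeasure η ξ) =
    quenchedMoment η p n ξ * childSum p y := by
  have hw : ∀ i : ℕ, Measurable fun z : ℕ → Marks => mass n (z i) ^ p := fun i =>
    ((measurable_mass n).comp (measurable_pi_apply i)).pow_const p
  simp_rw [ENNReal.mul_rpow_of_nonneg _ _ hp]
  rw [lintegral_finsetSum _ fun i _ => (hw i).const_mul _, childSum_eq, Finset.mul_sum]
  refine Finset.sum_congr rfl fun i _ => ?_
  rw [lintegral_const_mul _ (hw i), mul_comm]
  congr 1
  exact lintegral_eval_infinitePi _ i ((measurable_mass n).pow_const p)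

theorem mul_le_quenchedMoment_succ {p : ℝ} (hp : 1 < p) (n : ℕ) (ξ : ℕ → Θ) :
    m η 0 p ξ * quenchedMoment η p n (shift ξ) ≤ quenchedMoment η p (n + 1) ξ := by
  rw [quenchedMoment_succ, m_zero_eq, mul_comm, ← lintegral_const_mul _ (measurable_childSum p)]
  refine lintegral_mono fun y => ?_
  rw [← lintegral_mass_rpow_sum η _ p n (by linarith) y]
  exact lintegral_mono fun z => sum_rpow_le_rpow_sum _ _ hp

/-- The strict gain occurs when the first two children carry mass and so do their subtrees. These
subtrees are independent only given the environment, whence the square of a quenched probability. -/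
theorem exists_le_quenchedMoment_succ {p : ℝ} (hp : 1 < p) {δ s : ℝ≥0∞} (hδ : δ ≠ 0) (hs : s ≠ 0) :
    ∃ c : ℝ≥0∞, c ≠ 0 ∧ ∀ (n : ℕ) (ξ : ℕ → Θ),
      m η 0 p ξ * quenchedMoment η p n (shift ξ) +
        c * η (ξ 0) (twoChildren δ) * quenchedMeasure η (shift ξ) {x | s ≤ mass n x} ^ 2 ≤
      quenchedMoment η p (n + 1) ξ := by
  obtain ⟨c, hc, h⟩ := exists_rpow_sum_ge hp (mul_ne_zero hδ hs)
  refine ⟨c, hc, fun n ξ => ?_⟩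
  set Q := quenchedMeasure η (shift ξ) with hQ
  set S := {x | s ≤ mass n x} with hS
  have hSm : MeasurableSet S := measurableSet_le measurable_const (measurable_mass n)
  have hI : Measurable (S.indicator fun _ => (1 : ℝ≥0∞)) := measurable_const.indicator hSm
  have hIi : ∀ i : ℕ, Measurable fun z : ℕ → Marks => S.indicator (fun _ => (1 : ℝ≥0∞)) (z i) :=
    fun i => hI.comp (measurable_pi_apply i)
  have hII : Measurable fun z : ℕ → Marks =>
      S.indicator (fun _ => (1 : ℝ≥0∞)) (z 0) * S.indicator (fun _ => 1) (z 1) := (hIi 0).mul (hIi 1)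
  have hsq : ∫⁻ z, S.indicator (fun _ => 1) (z 0) * S.indicator (fun _ => 1) (z 1)
      ∂(Measure.infinitePi fun _ : ℕ => Q) = Q S ^ 2 := by
    have h1 := lintegral_mul_eq_lintegral_mul_lintegral_of_indepFun (hIi 0) (hIi 1)
      (indepFun_eval_infinitePi Q zero_ne_one hI hI)
    have h2 : ∀ i : ℕ, ∫⁻ z, S.indicator (fun _ => (1 : ℝ≥0∞)) (z i)
        ∂(Measure.infinitePi fun _ : ℕ => Q) = Q S := fun i => by
      rw [lintegral_eval_infinitePi Q i hI, lintegral_indicator hSm]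
      simp
    rw [h2, h2, ← pow_two] at h1
    exact h1
  rw [quenchedMoment_succ, m_zero_eq]
  set α := quenchedMoment η p n (shift ξ) with hα
  calc _ = ∫⁻ y, α * childSum p y +
        (c * Q S ^ 2) * (twoChildren δ).indicator (fun _ => 1) y ∂(η (ξ 0)) := by
        rw [lintegral_add_left ((measurable_childSum p).const_mul _),
          lintegral_const_mul _ (measurable_childSum p), lintegral_const_mul _
            (measurable_const.indicator (measurableSet_twoChildren δ)),
          lintegral_indicator (measurableSet_twoChildren δ)]
        simp only [lintegral_const, Measure.restrict_apply_univ, one_mul]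
        ring
    _ ≤ _ := by
        refine lintegral_mono fun y => ?_
        change α * childSum p y + (c * Q S ^ 2) * (twoChildren δ).indicator (fun _ => 1) y ≤ _
        have hsum : _ = α * childSum p y := lintegral_mass_rpow_sum η (shift ξ) p n (by linarith) y
        by_cases hy : y ∈ twoChildren δ
        · rw [Set.indicator_of_mem hy, mul_one, ← hsum, ← hsq, ← lintegral_const_mul _ hII,
            ← lintegral_add_right _ (hII.const_mul _)]
          refine lintegral_mono fun z => ?_
          -- Only when both subtrees are heavy is the gain `c` used; otherwise plain superadditivity
          -- suffices.
          by_cases hz : z 0 ∈ S ∧ z 1 ∈ S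
          · refine le_trans (le_of_eq ?_) (h y.1 _ hy.1 (mul_le_mul' hy.2.1 hz.1)
              (mul_le_mul' hy.2.2 hz.2))
            simp [hz.1, hz.2]
          · refine le_trans (le_of_eq ?_) (sum_rpow_le_rpow_sum _ _ hp)
            rcases not_and_or.1 hz with hz | hz <;> simp [hz]
        · rw [Set.indicator_of_notMem hy, mul_zero, add_zero, ← hsum]
          exact lintegral_mono fun z => sum_rpow_le_rpow_sum _ _ hp

end RootRecursion

/-! ### Recursive inequalities for numerical sequences -/

section Sequences

theorem exists_bound_of_le_mul_add {a : ℕ → ℝ≥0∞} {κ D : ℝ≥0∞} (h0 : a 0 ≤ 1) (hκ : κ < 1)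
    (hD : D ≠ ∞) (h : ∀ n, a (n + 1) ≤ κ * a n + D) : ∃ B : ℝ≥0∞, B ≠ ∞ ∧ ∀ n, a n ≤ B := by
  have hs0 : 1 - κ ≠ 0 := (tsub_pos_of_lt hκ).ne'
  have hst : 1 - κ ≠ ∞ := ENNReal.sub_ne_top ENNReal.one_ne_top
  have hB : (1 + D) / (1 - κ) * (1 - κ) = 1 + D := ENNReal.div_mul_cancel hs0 hst
  -- The fixed point of `x ↦ κ * x + (1 + D)`; the extra `1` ensures that it dominates `a 0`.
  refine ⟨(1 + D) / (1 - κ), ENNReal.div_ne_top (by simp [hD]) hs0, fun n => ?_⟩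
  set B := (1 + D) / (1 - κ) with hBdef
  have h1 : 1 + D ≤ B := by
    calc 1 + D = B * (1 - κ) := hB.symm
      _ ≤ B * 1 := by gcongr; exact tsub_le_self
      _ = B := mul_one B
  induction n with
  | zero => exact h0.trans (le_self_add.trans h1)
  | succ n ih =>
    calc a (n + 1) ≤ κ * B + (1 + D) := (h n).trans (by gcongr; exact le_add_self)
      _ = κ * B + B * (1 - κ) := by rw [hB]
      _ = (κ + (1 - κ)) * B := by ring
      _ = B := by rw [add_tsub_cancel_of_le hκ.le, one_mul]

theorem eq_zero_of_bounded_of_add_le {a : ℕ → ℝ≥0∞} {κ B : ℝ≥0∞} (hB : B ≠ ∞) (hbd : ∀ n, a n ≤ B)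
    (h : ∀ n, a n + κ ≤ a (n + 1)) : κ = 0 := by
  by_contra hκ
  have hn : ∀ n : ℕ, n * κ ≤ a n := by
    intro n
    induction n with
    | zero => simp
    | succ n ih =>
      rw [Nat.cast_succ, add_mul, one_mul]
      exact (add_le_add_left ih κ).trans (h n)
  obtain ⟨n, hn'⟩ := ENNReal.exists_nat_mul_gt hκ hB
  exact absurd ((hn n).trans (hbd n)) (not_le.2 hn')

theorem le_add_inv_mul_rpow {p : ℝ} (hp : 1 < p) {K : ℝ≥0∞} (hK : K ≠ 0) (hK' : K ≠ ∞) (y : ℝ≥0∞) :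
    y ≤ K + (K ^ (p - 1))⁻¹ * y ^ p := by
  rcases le_total y K with h | h
  · exact h.trans le_self_add
  · refine le_trans ?_ le_add_self
    have h0 : K ^ (p - 1) ≠ 0 := by simp [ENNReal.rpow_eq_zero_iff, hK, hK']
    have ht : K ^ (p - 1) ≠ ∞ := ENNReal.rpow_ne_top_of_nonneg (by linarith) hK'
    rw [mul_comm, ← div_eq_mul_inv, ENNReal.le_div_iff_mul_le (.inl h0) (.inl ht),
      rpow_eq_mul_rpow_sub_one hp y]
    gcongr

end Sequences

/-! ### Paley–Zygmund, second moments and the equality case of Jensen -/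

section Jensen

variable {Ω : Type*} [MeasurableSpace Ω] {μ : Measure Ω} [IsProbabilityMeasure μ]

/-- A form of the Paley–Zygmund inequality. -/
theorem exists_le_measure_half_le {p : ℝ} (hp : 1 < p) {B : ℝ≥0∞} (hB : B ≠ ∞) :
    ∃ t : ℝ≥0∞, t ≠ 0 ∧ t ≠ ∞ ∧ ∀ {Ω : Type _} [MeasurableSpace Ω] {μ : Measure Ω}
      [IsProbabilityMeasure μ] {f : Ω → ℝ≥0∞} (_ : Measurable f) (_ : ∫⁻ ω, f ω ∂μ = 1)
      (_ : ∫⁻ ω, f ω ^ p ∂μ ≤ B), t ≤ μ {ω | 2⁻¹ ≤ f ω} := by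
  -- The part of `f` above the cut-off `K`, where `K ^ (p - 1) = J`, contributes at most `B / J ≤
  -- 1/4` to the mean, and the part below `1/2` at most `1/2`. The remaining `1/4` is at most `K * μ
  -- S`.
  set J : ℝ≥0∞ := 4 * (B + 1) with hJ
  have hJ0 : J ≠ 0 := by simp [hJ]
  have hJt : J ≠ ∞ := by rw [hJ]; exact ENNReal.mul_ne_top (by simp) (by simp [hB])
  have hp1 : 0 < p - 1 := by linarith
  set K := J ^ (p - 1)⁻¹ with hK
  have hKJ : K ^ (p - 1) = J := by
    rw [hK, ← ENNReal.rpow_mul, inv_mul_cancel₀ hp1.ne', ENNReal.rpow_one]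
  have hK0 : K ≠ 0 := by
    intro h
    rw [h, ENNReal.zero_rpow_of_pos hp1] at hKJ
    exact hJ0 hKJ.symm
  have hKt : K ≠ ∞ := by rw [hK]; exact ENNReal.rpow_ne_top_of_nonneg (inv_pos.2 hp1).le hJt
  refine ⟨4⁻¹ / K, ?_, ENNReal.div_ne_top (by simp) hK0, fun {Ω} _ {μ} _ {f} hf h1 hfB => ?_⟩
  · simp [ENNReal.div_eq_zero_iff, hKt]
  set S := {ω | 2⁻¹ ≤ f ω} with hS
  have hSm : MeasurableSet S := measurableSet_le measurable_const hf
  have hI : Measurable (S.indicator fun _ => (1 : ℝ≥0∞)) := measurable_const.indicator hSm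
  have hpt : ∀ ω, f ω ≤ 2⁻¹ + (K * S.indicator (fun _ => 1) ω + J⁻¹ * f ω ^ p) := by
    intro ω
    by_cases hω : ω ∈ S
    · rw [Set.indicator_of_mem hω, mul_one, ← hKJ]
      exact (le_add_inv_mul_rpow hp hK0 hKt _).trans le_add_self
    · exact (not_le.1 hω).le.trans le_self_add
  have hint : (1 : ℝ≥0∞) ≤ 2⁻¹ + (K * μ S + J⁻¹ * B) := by
    calc (1 : ℝ≥0∞) = ∫⁻ ω, f ω ∂μ := h1.symm
      _ ≤ ∫⁻ ω, 2⁻¹ + (K * S.indicator (fun _ => 1) ω + J⁻¹ * f ω ^ p) ∂μ := lintegral_mono hpt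
      _ = 2⁻¹ + (K * μ S + J⁻¹ * ∫⁻ ω, f ω ^ p ∂μ) := by
        rw [lintegral_add_left measurable_const, lintegral_add_left (hI.const_mul K),
          lintegral_const_mul _ hI, lintegral_const_mul _ (hf.pow_const p),
          lintegral_indicator hSm]
        simp
      _ ≤ _ := by gcongr
  have hJB : J⁻¹ * B ≤ 4⁻¹ := by
    rw [hJ, ENNReal.mul_inv (by simp) (by simp), mul_assoc]
    calc (4 : ℝ≥0∞)⁻¹ * ((B + 1)⁻¹ * B) ≤ 4⁻¹ * ((B + 1)⁻¹ * (B + 1)) := by gcongr; exact le_self_add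
      _ = 4⁻¹ := by rw [ENNReal.inv_mul_cancel (by simp) (by simp [hB]), mul_one]
  rw [ENNReal.div_le_iff_le_mul (.inl hK0) (.inl hKt), mul_comm]
  have hfin : K * μ S ≠ ∞ := ENNReal.mul_ne_top hKt (measure_ne_top _ _)
  have h3 : (1 : ℝ≥0∞) ≤ 2⁻¹ + (K * μ S + 4⁻¹) := hint.trans (by gcongr)
  have h4 := ENNReal.toReal_mono (by finiteness) h3
  rw [ENNReal.toReal_add (by finiteness) (by finiteness),
    ENNReal.toReal_add (by finiteness) (by finiteness)] at h4
  rw [← ENNReal.toReal_le_toReal (by finiteness) hfin]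
  simp only [ENNReal.toReal_inv, ENNReal.toReal_ofNat, ENNReal.toReal_one] at h4 ⊢
  linarith

/-- Integrating `f ≤ t / 2 + (t / 2)⁻¹ * f ^ 2` gives Cauchy–Schwarz up to the factor `1/4`, which
is harmless here. -/
theorem mul_le_lintegral_sq {f : Ω → ℝ≥0∞} (hf : Measurable f) {t : ℝ≥0∞} (ht0 : t ≠ 0) (ht : t ≠ ∞)
    (h : t ≤ ∫⁻ ω, f ω ∂μ) : t / 2 * (t / 2) ≤ ∫⁻ ω, f ω ^ 2 ∂μ := by
  have h0 : t / 2 ≠ 0 := by simp [ENNReal.div_eq_zero_iff, ht0]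
  have h1 : t / 2 ≠ ∞ := ENNReal.div_ne_top ht (by simp)
  have hpt : ∀ ω, f ω ≤ t / 2 + (t / 2)⁻¹ * f ω ^ 2 := fun ω => by
    have := le_add_inv_mul_rpow one_lt_two h0 h1 (f ω)
    norm_num at this
    exact_mod_cast this
  have h2 : t / 2 + t / 2 ≤ t / 2 + (t / 2)⁻¹ * ∫⁻ ω, f ω ^ 2 ∂μ := by
    calc t / 2 + t / 2 = t := ENNReal.add_halves t
      _ ≤ ∫⁻ ω, t / 2 + (t / 2)⁻¹ * f ω ^ 2 ∂μ := h.trans (lintegral_mono hpt)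
      _ = _ := by
        rw [lintegral_add_left measurable_const, lintegral_const_mul _ (hf.pow_const 2)]
        simp
  have h3 := (ENNReal.add_le_add_iff_left h1).1 h2
  calc t / 2 * (t / 2) ≤ t / 2 * ((t / 2)⁻¹ * ∫⁻ ω, f ω ^ 2 ∂μ) := by gcongr
    _ = _ := by rw [← mul_assoc, ENNReal.mul_inv_cancel h0 h1, one_mul]

/-- Bernoulli's inequality `p * x ≤ x ^ p + (p - 1)` is strict off `x = 1`. The left side integrates
to `p` and the right side to at most `p`, so equality holds almost everywhere. -/
theorem ae_eq_one_of_lintegral_rpow_le_one {p : ℝ} (hp : 1 < p) {f : Ω → ℝ≥0∞} (hf : Measurable f)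
    (hft : ∀ ω, f ω ≠ ∞) (h1 : ∫⁻ ω, f ω ∂μ = 1) (h2 : ∫⁻ ω, f ω ^ p ∂μ ≤ 1) :
    ∀ᵐ ω ∂μ, f ω = 1 := by
  have hreal : ∀ x : ℝ, 0 ≤ x → x ≠ 1 → p * x < x ^ p + (p - 1) := by
    intro x hx hx1
    have := one_add_mul_self_lt_rpow_one_add (s := x - 1) (by linarith)
      (sub_ne_zero.2 hx1) hp
    rw [add_sub_cancel] at this
    linarith
  have hlt : ∀ ω, f ω ≠ 1 → ENNReal.ofReal p * f ω < f ω ^ p + ENNReal.ofReal (p - 1) := by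
    intro ω hω
    have h3 : (f ω).toReal ≠ 1 := by simpa [ENNReal.toReal_eq_one_iff] using hω
    have h4 := hreal _ ENNReal.toReal_nonneg h3
    have hpow : 0 ≤ (f ω).toReal ^ p := Real.rpow_nonneg ENNReal.toReal_nonneg p
    rw [← ENNReal.ofReal_toReal (hft ω), ENNReal.ofReal_rpow_of_nonneg ENNReal.toReal_nonneg
      (by linarith), ← ENNReal.ofReal_add hpow (by linarith),
      ← ENNReal.ofReal_mul (by linarith), ENNReal.ofReal_lt_ofReal_iff_of_nonneg (by positivity)]
    exact h4
  have hle : ∀ ω, ENNReal.ofReal p * f ω ≤ f ω ^ p + ENNReal.ofReal (p - 1) := by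
    intro ω
    by_cases hω : f ω = 1
    · rw [hω, mul_one, ENNReal.one_rpow, ← ENNReal.ofReal_one,
        ← ENNReal.ofReal_add zero_le_one (by linarith)]
      exact ENNReal.ofReal_le_ofReal (by linarith)
    · exact (hlt ω hω).le
  have hintl : ∫⁻ ω, ENNReal.ofReal p * f ω ∂μ = ENNReal.ofReal p := by
    rw [lintegral_const_mul _ hf, h1, mul_one]
  have hintr : ∫⁻ ω, f ω ^ p + ENNReal.ofReal (p - 1) ∂μ ≤ ENNReal.ofReal p := by
    rw [lintegral_add_right _ measurable_const]
    calc _ ≤ 1 + ENNReal.ofReal (p - 1) := by gcongr; simp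
      _ = ENNReal.ofReal p := by
        rw [← ENNReal.ofReal_one, ← ENNReal.ofReal_add zero_le_one (by linarith)]
        congr 1; ring
  have hae := ae_eq_of_ae_le_of_lintegral_le (ae_of_all μ hle) (by rw [hintl]; simp)
    ((hf.pow_const p).add_const _).aemeasurable (by rw [hintl]; exact hintr)
  filter_upwards [hae] with ω hω
  by_contra hne
  exact (hlt ω hne).ne hω

end Jensen

/-! ### Boundedness of the annealed moments -/

section Annealed

variable {Θ : Type*} [MeasurableSpace Θ]

section

variable (η : Kernel Θ Mark)

theorem measurable_lintegral_childSum (p : ℝ) : Measurable fun θ : Θ => ∫⁻ y, childSum p y ∂(η θ) :=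
  (measurable_childSum p).lintegral_kernel

theorem measurable_m (n : ℕ) (p : ℝ) : Measurable (m η n p) :=
  (measurable_lintegral_childSum η p).comp (measurable_pi_apply n)

theorem P_eq_one {ξ : ℕ → Θ} (h : ∀ n, m η n 1 ξ = 1) (n : ℕ) : P η n 1 ξ = 1 :=
  Finset.prod_eq_one fun i _ => h i

variable {τ : Measure (ℕ → Θ)}

theorem ae_m_eq_one
    (h_ident : ∀ n : ℕ, IdentDistrib (fun ξ : ℕ → Θ => ξ n) (fun ξ : ℕ → Θ => ξ 0) τ τ)
    (h_mean : ∀ᵐ ξ ∂τ, m η 0 1 ξ = 1) : ∀ᵐ ξ ∂τ, ∀ n, m η n 1 ξ = 1 := by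
  refine ae_all_iff.2 fun n => ?_
  exact (h_ident n).symm.ae_snd (p := fun θ => ∫⁻ y, childSum 1 y ∂(η θ) = 1)
    (measurableSet_eq_fun (measurable_lintegral_childSum η 1) measurable_const) h_mean

theorem lintegral_m_mul_shift (h_indep : iIndepFun (fun (n : ℕ) (ξ : ℕ → Θ) => ξ n) τ)
    (h_ident : ∀ n : ℕ, IdentDistrib (fun ξ : ℕ → Θ => ξ n) (fun ξ : ℕ → Θ => ξ 0) τ τ) (p : ℝ)
    {g : (ℕ → Θ) → ℝ≥0∞} (hg : Measurable g) :
    ∫⁻ ξ, m η 0 p ξ * g (shift ξ) ∂τ = (∫⁻ ξ, m η 0 p ξ ∂τ) * ∫⁻ ξ, g ξ ∂τ :=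
  lintegral_zero_mul_shift h_indep h_ident (measurable_lintegral_childSum η p) hg

end

variable (τ : Measure (ℕ → Θ)) (η : Kernel Θ Mark) [IsMarkovKernel η]

/-- `𝔼 (∑_{|u| = n} exp (S_u))^p`. -/
noncomputable def annealedMoment (p : ℝ) (n : ℕ) : ℝ≥0∞ := ∫⁻ ξ, quenchedMoment η p n ξ ∂τ

variable {τ} [IsProbabilityMeasure τ]

theorem annealedMoment_zero (p : ℝ) : annealedMoment τ η p 0 = 1 := by
  simp [annealedMoment, quenchedMoment_zero]

theorem annealedMoment_bounded (h_indep : iIndepFun (fun (n : ℕ) (ξ : ℕ → Θ) => ξ n) τ)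
    (h_ident : ∀ n : ℕ, IdentDistrib (fun ξ : ℕ → Θ => ξ n) (fun ξ : ℕ → Θ => ξ 0) τ τ)
    (h_mean : ∀ᵐ ξ ∂τ, m η 0 1 ξ = 1) {p : ℝ} (hp : 1 < p) (hV : annealedMoment τ η p 1 ≠ ∞)
    (hb : ∫⁻ ξ, m η 0 p ξ ∂τ < 1) : ∃ B : ℝ≥0∞, B ≠ ∞ ∧ ∀ n, annealedMoment τ η p n ≤ B := by
  set b := ∫⁻ ξ, m η 0 p ξ ∂τ with hbdef
  set V := annealedMoment τ η p 1 with hVdef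
  -- For `b ≠ 0`, take `r = ρ / b` with `b < ρ < 1`.
  obtain ⟨r, hr, hr', hrb⟩ : ∃ r : ℝ≥0∞, 1 < r ∧ r ≠ ∞ ∧ r * b < 1 := by
    rcases eq_or_ne b 0 with h0 | h0
    · exact ⟨2, ENNReal.one_lt_two, by simp, by simp [h0]⟩
    · obtain ⟨ρ, h1, h2⟩ := exists_between hb
      refine ⟨ρ / b, ?_, ENNReal.div_ne_top h2.ne_top h0, ?_⟩
      · rw [ENNReal.lt_div_iff_mul_lt (.inl h0) (.inl hb.ne_top), one_mul]
        exact h1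
      · rwa [ENNReal.div_mul_cancel h0 hb.ne_top]
  obtain ⟨C, hC, hrec⟩ := exists_quenchedMoment_succ_le η hp hr hr'
  obtain ⟨κ, hκ1, hκ2⟩ := exists_between hrb
  have hD : C * V ≠ ∞ := ENNReal.mul_ne_top hC hV
  set D := C * V with hDdef
  -- `e` is the room left for the cross terms; `K` is chosen so that `D / K ≤ e`, and the `+ 1` in
  -- its numerator keeps it nonzero.
  set e := κ - r * b with he
  have he0 : e ≠ 0 := (tsub_pos_of_lt hκ1).ne'
  have het : e ≠ ∞ := ENNReal.sub_ne_top hκ2.ne_top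
  set K := (D + 1) / e with hK
  have hK0 : K ≠ 0 := by simp [hK, ENNReal.div_eq_zero_iff, het]
  have hKt : K ≠ ∞ := ENNReal.div_ne_top (by simp [hD]) he0
  have hDK : D * K⁻¹ ≤ e := by
    rw [← div_eq_mul_inv, ENNReal.div_le_iff_le_mul (.inl hK0) (.inl hKt), hK,
      ENNReal.mul_div_cancel he0 het]
    exact le_self_add
  refine exists_bound_of_le_mul_add (κ := κ) (D := D * K ^ (p - 1)) (annealedMoment_zero η p).le hκ2
    (ENNReal.mul_ne_top hD (ENNReal.rpow_ne_top_of_nonneg (by linarith) hKt)) fun n => ?_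
  have hgood := ae_m_eq_one η h_ident h_mean
  set q := quenchedMoment η p n with hq
  have hqm : Measurable q := measurable_quenchedMoment η p n
  have hqs : Measurable fun ξ => K ^ (p - 1) + K⁻¹ * q ξ := (hqm.const_mul _).const_add _
  calc annealedMoment τ η p (n + 1)
      ≤ ∫⁻ ξ, r * (m η 0 p ξ * q (shift ξ)) +
          C * (quenchedMoment η p 1 ξ * (K ^ (p - 1) + K⁻¹ * q (shift ξ))) ∂τ := by
        refine lintegral_mono_ae ?_
        filter_upwards [hgood] with ξ hξ
        refine (hrec n ξ (P_eq_one η (fun k => hξ (k + 1)) n).le K hK0 hKt).trans (le_of_eq ?_)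
        ring
    _ = r * (b * annealedMoment τ η p n) + C * (V * ∫⁻ ξ, K ^ (p - 1) + K⁻¹ * q ξ ∂τ) := by
        have e1 := lintegral_m_mul_shift η h_indep h_ident p hqm
        have e2 : ∫⁻ ξ, quenchedMoment η p 1 ξ * (K ^ (p - 1) + K⁻¹ * q (shift ξ)) ∂τ =
            V * ∫⁻ ξ, K ^ (p - 1) + K⁻¹ * q ξ ∂τ := by
          rw [hVdef, annealedMoment]
          -- In this form the first-generation moment visibly depends on `ξ 0` alone, hence is
          -- independent of the shifted environment.
          simp_rw [quenchedMoment_one]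
          exact lintegral_zero_mul_shift h_indep h_ident
            ((measurable_childSum 1).pow_const p).lintegral_kernel hqs
        have m1 : Measurable fun ξ => m η 0 p ξ * q (shift ξ) :=
          (measurable_m η 0 p).mul (hqm.comp measurable_shift)
        have m2 : Measurable fun ξ => quenchedMoment η p 1 ξ * (K ^ (p - 1) + K⁻¹ * q (shift ξ)) :=
          (measurable_quenchedMoment η p 1).mul (hqs.comp measurable_shift)
        rw [lintegral_add_left (m1.const_mul r), lintegral_const_mul _ m1,
          lintegral_const_mul _ m2, e1, e2]
        rfl
    _ = r * b * annealedMoment τ η p n + (D * K⁻¹ * annealedMoment τ η p n + D * K ^ (p - 1)) := by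
        rw [lintegral_add_left measurable_const, lintegral_const_mul _ hqm, lintegral_const,
          measure_univ]
        change _ + C * (V * (_ + K⁻¹ * annealedMoment τ η p n)) = _
        rw [hDdef]
        ring
    _ ≤ r * b * annealedMoment τ η p n + (e * annealedMoment τ η p n + D * K ^ (p - 1)) := by
        gcongr
    _ = _ := by
        rw [← add_assoc, ← add_mul, he, add_tsub_cancel_of_le hκ1.le]

end Annealed

/-! ### Bounded moments force `𝔼 m_0(p) < 1` -/

section Necessity

variable {Θ : Type*} [MeasurableSpace Θ]

/-- The annealed law of the reproduction vector of the root. -/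
noncomputable def markLaw (τ : Measure (ℕ → Θ)) (η : Kernel Θ Mark) : Measure Mark :=
  (τ.map fun ξ => ξ 0).bind η

theorem lintegral_markLaw (τ : Measure (ℕ → Θ)) (η : Kernel Θ Mark) {f : Mark → ℝ≥0∞}
    (hf : Measurable f) : ∫⁻ y, f y ∂(markLaw τ η) = ∫⁻ ξ, ∫⁻ y, f y ∂(η (ξ 0)) ∂τ := by
  rw [markLaw, Measure.lintegral_bind η.measurable.aemeasurable hf.aemeasurable,
    lintegral_map hf.lintegral_kernel (measurable_pi_apply 0)]

theorem markLaw_apply (τ : Measure (ℕ → Θ)) (η : Kernel Θ Mark) {s : Set Mark}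
    (hs : MeasurableSet s) : markLaw τ η s = ∫⁻ ξ, η (ξ 0) s ∂τ := by
  have h := lintegral_markLaw τ η (f := s.indicator fun _ => 1) (measurable_const.indicator hs)
  simpa [lintegral_indicator hs] using h

theorem measurable_mass_snd (n : ℕ) : Measurable fun ω : (ℕ → Θ) × Marks => mass n ω.2 :=
  (measurable_mass n).comp measurable_snd

variable {τ : Measure (ℕ → Θ)} (η : Kernel Θ Mark) [IsMarkovKernel η]

theorem mul_le_annealedMoment_succ (h_indep : iIndepFun (fun (n : ℕ) (ξ : ℕ → Θ) => ξ n) τ)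
    (h_ident : ∀ n : ℕ, IdentDistrib (fun ξ : ℕ → Θ => ξ n) (fun ξ : ℕ → Θ => ξ 0) τ τ)
    {p : ℝ} (hp : 1 < p) (n : ℕ) :
    (∫⁻ ξ, m η 0 p ξ ∂τ) * annealedMoment τ η p n ≤ annealedMoment τ η p (n + 1) := by
  rw [annealedMoment, ← lintegral_m_mul_shift η h_indep h_ident p (measurable_quenchedMoment η p n)]
  exact lintegral_mono fun ξ => mul_le_quenchedMoment_succ η hp n ξ

variable [IsProbabilityMeasure τ]

theorem iUnion_twoChildren : ⋃ k : ℕ, twoChildren ((k + 1 : ℝ≥0∞)⁻¹) = {y | 2 ≤ y.1} := by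
  ext y
  simp only [Set.mem_iUnion]
  refine ⟨fun ⟨k, hk⟩ => hk.1, fun hy => ?_⟩
  have h1 : ∀ t : ℝ, ENNReal.ofReal (Real.exp t) ≠ 0 := fun t => by
    simp [Real.exp_pos]
  have hmin : min (ENNReal.ofReal (Real.exp (y.2 0))) (ENNReal.ofReal (Real.exp (y.2 1))) ≠ 0 :=
    (lt_min (pos_iff_ne_zero.2 (h1 _)) (pos_iff_ne_zero.2 (h1 _))).ne'
  obtain ⟨k, hk⟩ := ENNReal.exists_inv_nat_lt hmin
  have hk' : (k + 1 : ℝ≥0∞)⁻¹ ≤ (k : ℝ≥0∞)⁻¹ := ENNReal.inv_le_inv.2 le_self_add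
  exact ⟨k, hy, (hk'.trans hk.le).trans (min_le_left _ _), (hk'.trans hk.le).trans (min_le_right _ _)⟩

theorem childSum_rpow_of_lt_two {p : ℝ} (hp : 1 < p) {y : Mark} (hy : y.1 < 2) :
    childSum 1 y ^ p = childSum p y := by
  rw [childSum_one_eq, childSum_eq]
  have h : y.1 = 0 ∨ y.1 = 1 := by omega
  rcases h with h | h
  · simp [h, ENNReal.zero_rpow_of_pos (zero_lt_one.trans hp)]
  · simp [h]

theorem lintegral_mass_annealed
    (h_ident : ∀ n : ℕ, IdentDistrib (fun ξ : ℕ → Θ => ξ n) (fun ξ : ℕ → Θ => ξ 0) τ τ)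
    (h_mean : ∀ᵐ ξ ∂τ, m η 0 1 ξ = 1) (n : ℕ) :
    ∫⁻ ω, mass n ω.2 ∂(annealed τ η) = 1 := by
  rw [annealed, Measure.lintegral_compProd (measurable_mass_snd n)]
  have h : ∫⁻ ξ, ∫⁻ x, mass n x ∂(quenched η ξ) ∂τ = ∫⁻ _, 1 ∂τ := by
    refine lintegral_congr_ae ?_
    filter_upwards [ae_m_eq_one η h_ident h_mean] with ξ hξ
    rw [quenched_apply, lintegral_mass, P_eq_one η hξ]
  simpa using h

theorem lintegral_mass_rpow_annealed (p : ℝ) (n : ℕ) :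
    ∫⁻ ω, mass n ω.2 ^ p ∂(annealed τ η) = annealedMoment τ η p n := by
  rw [annealed, Measure.lintegral_compProd ((measurable_mass_snd n).pow_const p)]
  rfl

instance : IsProbabilityMeasure (annealed τ η) := by
  unfold annealed; infer_instance

/-- Jensen's inequality, read off from its equality case: a moment below `1` would force the mass to
be `1` almost surely, and then the moment would equal `1`. -/
theorem annealedMoment_ge_one
    (h_ident : ∀ n : ℕ, IdentDistrib (fun ξ : ℕ → Θ => ξ n) (fun ξ : ℕ → Θ => ξ 0) τ τ)
    (h_mean : ∀ᵐ ξ ∂τ, m η 0 1 ξ = 1) {p : ℝ} (hp : 1 < p) (n : ℕ) :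
    1 ≤ annealedMoment τ η p n := by
  have hm := measurable_mass_snd (Θ := Θ) n
  have h1 := lintegral_mass_annealed η h_ident h_mean n
  by_contra! hlt
  have h2 := ae_eq_one_of_lintegral_rpow_le_one hp hm (fun ω => mass_ne_top n _) h1
    ((lintegral_mass_rpow_annealed η p n).trans_le hlt.le)
  have h3 : annealedMoment τ η p n = 1 := by
    rw [← lintegral_mass_rpow_annealed, lintegral_congr_ae (g := fun _ => 1)]
    · simp
    · filter_upwards [h2] with ω hω
      rw [hω, ENNReal.one_rpow]
  exact hlt.ne h3

/-- When `𝔼 m_0(p) ≥ 1`, each generation adds to the annealed moment at least a multiple of this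
probability that does not depend on `n`, since generation `n` has mass at least `1/2` with
probability bounded below. A bounded sequence leaves no room for such an increment. -/
theorem markLaw_twoChildren_eq_zero (h_indep : iIndepFun (fun (n : ℕ) (ξ : ℕ → Θ) => ξ n) τ)
    (h_ident : ∀ n : ℕ, IdentDistrib (fun ξ : ℕ → Θ => ξ n) (fun ξ : ℕ → Θ => ξ 0) τ τ)
    (h_mean : ∀ᵐ ξ ∂τ, m η 0 1 ξ = 1) {p : ℝ} (hp : 1 < p) {B : ℝ≥0∞} (hB : B ≠ ∞)
    (hbd : ∀ n, annealedMoment τ η p n ≤ B) (hb : 1 ≤ ∫⁻ ξ, m η 0 p ξ ∂τ) {δ : ℝ≥0∞} (hδ : δ ≠ 0) :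
    markLaw τ η (twoChildren δ) = 0 := by
  obtain ⟨t, ht0, ht, hpz⟩ := exists_le_measure_half_le hp hB
  obtain ⟨c, hc, hrec⟩ := exists_le_quenchedMoment_succ η hp hδ (s := 2⁻¹) (by simp)
  have hkey : c * markLaw τ η (twoChildren δ) * (t / 2 * (t / 2)) = 0 := by
    refine eq_zero_of_bounded_of_add_le hB hbd fun n => ?_
    set S : Set Marks := {x | 2⁻¹ ≤ mass n x} with hS
    have hSm : MeasurableSet S := measurableSet_le measurable_const (measurable_mass n)
    have hQ : Measurable fun ξ => quenchedMeasure η ξ S := (quenched η).measurable_coe hSm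
    have hprob : t ≤ ∫⁻ ξ, quenchedMeasure η ξ S ∂τ := by
      have h1 := hpz (μ := annealed τ η) (measurable_mass_snd n)
        (lintegral_mass_annealed η h_ident h_mean n)
        ((lintegral_mass_rpow_annealed η p n).trans_le (hbd n))
      have h2 : annealed τ η (Prod.snd ⁻¹' S) = ∫⁻ ξ, quenchedMeasure η ξ S ∂τ := by
        rw [annealed, Measure.compProd_apply (measurable_snd hSm)]
        rfl
      exact h1.trans h2.le
    -- Sibling subtrees share the environment, so the mean of the squared quenched probability is
    -- needed; it is bounded below through the annealed probability.
    have hsq := mul_le_lintegral_sq hQ ht0 ht hprob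
    have e1 := lintegral_m_mul_shift η h_indep h_ident p (measurable_quenchedMoment η p n)
    have e2 : ∫⁻ ξ, η (ξ 0) (twoChildren δ) * quenchedMeasure η (shift ξ) S ^ 2 ∂τ =
        markLaw τ η (twoChildren δ) * ∫⁻ ξ, quenchedMeasure η ξ S ^ 2 ∂τ := by
      rw [markLaw_apply τ η (measurableSet_twoChildren δ)]
      exact lintegral_zero_mul_shift h_indep h_ident
        (η.measurable_coe (measurableSet_twoChildren δ)) (hQ.pow_const 2)
    have m1 : Measurable fun ξ => m η 0 p ξ * quenchedMoment η p n (shift ξ) :=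
      (measurable_m η 0 p).mul ((measurable_quenchedMoment η p n).comp measurable_shift)
    have m2 : Measurable fun ξ : ℕ → Θ =>
        η (ξ 0) (twoChildren δ) * quenchedMeasure η (shift ξ) S ^ 2 :=
      ((η.measurable_coe (measurableSet_twoChildren δ)).comp (measurable_pi_apply 0)).mul
        ((hQ.comp measurable_shift).pow_const 2)
    calc annealedMoment τ η p n + c * markLaw τ η (twoChildren δ) * (t / 2 * (t / 2))
        ≤ (∫⁻ ξ, m η 0 p ξ ∂τ) * annealedMoment τ η p n +
          c * (markLaw τ η (twoChildren δ) * ∫⁻ ξ, quenchedMeasure η ξ S ^ 2 ∂τ) := by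
          rw [mul_assoc]
          gcongr
          exact le_mul_of_one_le_left zero_le hb
      _ = ∫⁻ ξ, m η 0 p ξ * quenchedMoment η p n (shift ξ) +
          c * (η (ξ 0) (twoChildren δ) * quenchedMeasure η (shift ξ) S ^ 2) ∂τ := by
          rw [lintegral_add_left m1, lintegral_const_mul _ m2, e1, e2]
          rfl
      _ ≤ annealedMoment τ η p (n + 1) := lintegral_mono fun ξ => by
          rw [← mul_assoc]
          exact hrec n ξ
  have ht2 : t / 2 ≠ 0 := by simp [ENNReal.div_eq_zero_iff, ht0]
  simpa [hc, ht2] using hkey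

/-- With at most one child there is no cross term, so `𝔼 W_1^p = 𝔼 m_0(p)`. If this is at least `1`,
boundedness makes it exactly `1`, and the equality case of Jensen contradicts nontriviality. -/
theorem lintegral_m_lt_one_of_bounded (h_indep : iIndepFun (fun (n : ℕ) (ξ : ℕ → Θ) => ξ n) τ)
    (h_ident : ∀ n : ℕ, IdentDistrib (fun ξ : ℕ → Θ => ξ n) (fun ξ : ℕ → Θ => ξ 0) τ τ)
    (h_mean : ∀ᵐ ξ ∂τ, m η 0 1 ξ = 1) {p : ℝ} (hp : 1 < p) {B : ℝ≥0∞} (hB : B ≠ ∞)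
    (hbd : ∀ n, annealedMoment τ η p n ≤ B)
    (hnt : ¬ ∀ᵐ ω ∂(annealed τ η), mass 1 ω.2 = 1) : ∫⁻ ξ, m η 0 p ξ ∂τ < 1 := by
  by_contra! hb
  have h2 : markLaw τ η {y | 2 ≤ y.1} = 0 := by
    rw [← iUnion_twoChildren]
    exact measure_iUnion_null fun k =>
      markLaw_twoChildren_eq_zero η h_indep h_ident h_mean hp hB hbd hb (by simp)
  have hV : annealedMoment τ η p 1 = ∫⁻ ξ, m η 0 p ξ ∂τ := by
    have e1 : annealedMoment τ η p 1 = ∫⁻ y, childSum 1 y ^ p ∂(markLaw τ η) := by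
      rw [lintegral_markLaw τ η ((measurable_childSum 1).pow_const p)]
      simp_rw [annealedMoment, quenchedMoment_one]
    have e2 : ∫⁻ ξ, m η 0 p ξ ∂τ = ∫⁻ y, childSum p y ∂(markLaw τ η) := by
      rw [lintegral_markLaw τ η (measurable_childSum p)]
      rfl
    rw [e1, e2]
    refine lintegral_congr_ae ?_
    have h3 : ∀ᵐ y ∂(markLaw τ η), ¬ 2 ≤ y.1 := by
      rw [ae_iff]
      simp only [not_not]
      exact h2
    filter_upwards [h3] with y hy
    exact childSum_rpow_of_lt_two hp (not_le.1 hy)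
  have hb1 : ∫⁻ ξ, m η 0 p ξ ∂τ ≤ 1 := by
    refine tsub_eq_zero_iff_le.1 (eq_zero_of_bounded_of_add_le hB hbd fun n => ?_)
    set b := ∫⁻ ξ, m η 0 p ξ ∂τ with hbdef
    calc annealedMoment τ η p n + (b - 1)
        ≤ annealedMoment τ η p n + (b - 1) * annealedMoment τ η p n := by
          gcongr
          exact le_mul_of_one_le_right zero_le (annealedMoment_ge_one η h_ident h_mean hp n)
      _ = (1 + (b - 1)) * annealedMoment τ η p n := by ring
      _ = b * annealedMoment τ η p n := by rw [add_tsub_cancel_of_le hb]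
      _ ≤ _ := mul_le_annealedMoment_succ η h_indep h_ident hp n
  exact hnt (ae_eq_one_of_lintegral_rpow_le_one hp (measurable_mass_snd 1)
    (fun ω => mass_ne_top 1 _) (lintegral_mass_annealed η h_ident h_mean 1)
    ((lintegral_mass_rpow_annealed η p 1).trans_le (hV.trans_le hb1)))

end Necessity

/-! ### Convergence of `L^p`-bounded martingales -/

section MartingaleLp

variable {Ω : Type*} {mΩ : MeasurableSpace Ω} {μ : Measure Ω}

/-- By Hölder, the integral of `|f n|` over `A` is at most `R * μ A ^ (1 - 1 / p)`. -/
theorem unifIntegrable_one_of_bounded {p : ℝ≥0∞} (hp : 1 < p) (hp' : p ≠ ∞) {f : ℕ → Ω → ℝ}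
    (hf : ∀ n, AEStronglyMeasurable (f n) μ) {R : ℝ≥0∞} (hR : R ≠ ∞) (h : ∀ n, eLpNorm (f n) p μ ≤ R) :
    UnifIntegrable f 1 μ := by
  have hp0 : 0 < p := zero_lt_one.trans hp
  have hs : 0 < 1 - 1 / p.toReal := by
    have : 1 < p.toReal := by
      rwa [← ENNReal.toReal_one, ENNReal.toReal_lt_toReal ENNReal.one_ne_top hp']
    rw [sub_pos, div_lt_one (by linarith)]
    exact this
  set s := 1 - 1 / p.toReal with hsdef
  intro ε hε
  have htend : Tendsto (fun δ : ℝ≥0∞ => R * δ ^ s) (𝓝 0) (𝓝 0) := by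
    have h1 : Tendsto (fun δ : ℝ≥0∞ => δ ^ s) (𝓝 0) (𝓝 0) := by
      have := (ENNReal.continuous_rpow_const (y := s)).tendsto 0
      rwa [ENNReal.zero_rpow_of_pos hs] at this
    simpa using ENNReal.Tendsto.const_mul h1 (.inr hR)
  obtain ⟨δ, hδ0, hδ⟩ := ENNReal.nhds_zero_basis_Iic.eventually_iff.1
    (htend.eventually (gt_mem_nhds (ENNReal.ofReal_pos.2 hε)))
  -- The threshold `δ` may be infinite, whereas a real one is required.
  have hδ1 : 0 < min δ 1 := lt_min hδ0 zero_lt_one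
  have hδt : min δ 1 ≠ ∞ := ((min_le_right _ _).trans_lt ENNReal.one_lt_top).ne
  refine ⟨(min δ 1).toReal, ENNReal.toReal_pos hδ1.ne' hδt, fun n A hA hμA => ?_⟩
  rw [ENNReal.ofReal_toReal hδt] at hμA
  rw [eLpNorm_indicator_eq_eLpNorm_restrict hA]
  calc eLpNorm (f n) 1 (μ.restrict A)
      ≤ eLpNorm (f n) p (μ.restrict A) * (μ.restrict A) Set.univ ^
          (1 / (1 : ℝ≥0∞).toReal - 1 / p.toReal) :=
        eLpNorm_le_eLpNorm_mul_rpow_measure_univ hp.le (hf n).restrict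
    _ ≤ R * (μ A) ^ s := by
        rw [Measure.restrict_apply_univ, hsdef, ENNReal.toReal_one, div_one]
        gcongr
        exact (eLpNorm_restrict_le _ _ _ _).trans (h n)
    _ ≤ ENNReal.ofReal ε := (hδ (hμA.trans (min_le_left _ _))).le

variable [IsProbabilityMeasure μ]

/-- Conditional Jensen bounds the `p`-th power of the conditional expectation of `g` by that of `|g|
^ p`, and the conditional expectations of one integrable function are uniformly integrable. -/
theorem unifIntegrable_condExp {p : ℝ} (hp : 1 < p) {g : Ω → ℝ}
    (hg : MemLp g (ENNReal.ofReal p) μ) {ℱ : Filtration ℕ mΩ} :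
    UnifIntegrable (fun n => μ[g | ℱ n]) (ENNReal.ofReal p) μ := by
  have hp0 : 0 < p := by linarith
  have hpe : ENNReal.ofReal p ≠ 0 := by simpa using hp0
  have hgp : Integrable (fun ω => ‖g ω‖ ^ p) μ := by
    have := hg.integrable_norm_rpow hpe ENNReal.ofReal_ne_top
    rwa [ENNReal.toReal_ofReal hp0.le] at this
  have hui := (hgp.uniformIntegrable_condExp_filtration (f := ℱ)).2.1
  intro ε hε
  obtain ⟨δ, hδ, h⟩ := hui (Real.rpow_pos_of_pos hε p)
  refine ⟨δ, hδ, fun n A hA hμA => ?_⟩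
  have h2 := h n A hA hμA
  have h3 : eLpNorm (A.indicator (μ[g | ℱ n])) (ENNReal.ofReal p) μ ^ p ≤ ENNReal.ofReal ε ^ p := by
    rw [ENNReal.ofReal_rpow_of_pos hε]
    refine le_trans ?_ h2
    rw [eLpNorm_indicator_eq_eLpNorm_restrict hA, eLpNorm_indicator_eq_eLpNorm_restrict hA,
      eLpNorm_eq_lintegral_rpow_enorm_toReal hpe ENNReal.ofReal_ne_top, ENNReal.toReal_ofReal hp0.le,
      ← ENNReal.rpow_mul, one_div_mul_cancel hp0.ne', ENNReal.rpow_one, eLpNorm_one_eq_lintegral_enorm]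
    refine lintegral_mono_ae (ae_restrict_of_ae ?_)
    filter_upwards [_root_.Integrable.norm_condExp_rpow_le (m := ℱ n) hp.le hgp] with ω hω
    rw [← ofReal_norm, ← ofReal_norm,
      ENNReal.ofReal_rpow_of_nonneg (norm_nonneg _) hp0.le]
    exact ENNReal.ofReal_le_ofReal (hω.trans (le_abs_self _))
  exact (ENNReal.rpow_le_rpow_iff hp0).1 h3

/-- An `L^p`-bounded martingale, `p > 1`, converges in `L^p` to its almost sure limit. -/
theorem tendsto_eLpNorm_of_martingale_bounded {p : ℝ} (hp : 1 < p) {f : ℕ → Ω → ℝ}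
    {ℱ : Filtration ℕ mΩ} (hf : Martingale f ℱ μ) {R : ℝ≥0∞} (hR : R ≠ ∞)
    (h : ∀ n, eLpNorm (f n) (ENNReal.ofReal p) μ ≤ R) {g : Ω → ℝ}
    (hg : ∀ᵐ ω ∂μ, Tendsto (fun n => f n ω) atTop (𝓝 (g ω))) :
    MemLp g (ENNReal.ofReal p) μ ∧
      Tendsto (fun n => eLpNorm (f n - g) (ENNReal.ofReal p) μ) atTop (𝓝 0) := by
  have h1p : 1 < ENNReal.ofReal p := ENNReal.one_lt_ofReal.2 hp
  have hm : ∀ n, AEStronglyMeasurable (f n) μ := fun n => (hf.integrable n).aestronglyMeasurable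
  have hgm : AEStronglyMeasurable g μ := aestronglyMeasurable_of_tendsto_ae atTop hm hg
  have hgL : MemLp g (ENNReal.ofReal p) μ :=
    ⟨hgm, (Lp.eLpNorm_le_of_ae_tendsto (Eventually.of_forall h) hm hg).trans_lt hR.lt_top⟩
  refine ⟨hgL, ?_⟩
  have hui1 := unifIntegrable_one_of_bounded h1p ENNReal.ofReal_ne_top hm hR h
  have hgi : MemLp g 1 μ := hgL.mono_exponent h1p.le
  have hL1 := tendsto_Lp_finite_of_tendsto_ae le_rfl ENNReal.one_ne_top hm hgi hui1 hg
  -- Convergence in `L^1` closes the martingale: `f n` is the conditional expectation of `g`, which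
  -- upgrades uniform integrability from order `1` to order `p`.
  have hcond := hf.eq_condExp_of_tendsto_eLpNorm (hgi.integrable le_rfl) hL1
  have hui : UnifIntegrable f (ENNReal.ofReal p) μ :=
    (unifIntegrable_condExp hp hgL (ℱ := ℱ)).ae_eq fun n => (hcond n).symm
  exact tendsto_Lp_finite_of_tendsto_ae h1p.le ENNReal.ofReal_ne_top hm hgL hui hg

end MartingaleLp

/-! ### The annealed martingale -/

section Martingale

variable {Θ : Type*} [MeasurableSpace Θ] {τ : Measure (ℕ → Θ)} [IsProbabilityMeasure τ]
  (η : Kernel Θ Mark) [IsMarkovKernel η]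

/-- The filtration generated by the environment and the reproduction vectors of the generations
before `n`. -/
def past (Θ : Type*) [MeasurableSpace Θ] :
    Filtration ℕ (inferInstance : MeasurableSpace ((ℕ → Θ) × Marks)) where
  seq n := MeasurableSpace.prod inferInstance (history n)
  mono' _ _ h := sup_le_sup le_rfl (MeasurableSpace.comap_mono (history_mono h))
  le' n := sup_le_sup le_rfl (MeasurableSpace.comap_mono (history_le n))

/-- For fixed `ξ`, the slice of an event of the past is an event of `history n`, so the quenched
martingale property applies to its indicator for almost every environment. -/
theorem setLIntegral_mass_succ
    (h_ident : ∀ n : ℕ, IdentDistrib (fun ξ : ℕ → Θ => ξ n) (fun ξ : ℕ → Θ => ξ 0) τ τ)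
    (h_mean : ∀ᵐ ξ ∂τ, m η 0 1 ξ = 1) (n : ℕ) {s : Set ((ℕ → Θ) × Marks)}
    (hs : MeasurableSet[past Θ n] s) :
    ∫⁻ ω in s, mass (n + 1) ω.2 ∂(annealed τ η) = ∫⁻ ω in s, mass n ω.2 ∂(annealed τ η) := by
  have hs' : MeasurableSet s := (past Θ).le n s hs
  have hform : ∀ k, ∫⁻ ω in s, mass k ω.2 ∂(annealed τ η) =
      ∫⁻ ξ, ∫⁻ x, (Prod.mk ξ ⁻¹' s).indicator (fun _ => 1) x * mass k x
        ∂(quenchedMeasure η ξ) ∂τ := by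
    intro k
    rw [← lintegral_indicator hs', annealed,
      Measure.lintegral_compProd ((measurable_mass_snd k).indicator hs')]
    refine lintegral_congr fun ξ => ?_
    rw [quenched_apply]
    refine lintegral_congr fun x => ?_
    by_cases hx : (ξ, x) ∈ s
    · have hx' : x ∈ Prod.mk ξ ⁻¹' s := hx
      rw [Set.indicator_of_mem hx, Set.indicator_of_mem hx', one_mul]
    · have hx' : x ∉ Prod.mk ξ ⁻¹' s := hx
      rw [Set.indicator_of_notMem hx, Set.indicator_of_notMem hx', zero_mul]
  rw [hform, hform]
  refine lintegral_congr_ae ?_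
  filter_upwards [ae_m_eq_one η h_ident h_mean] with ξ hξ
  have hslice : MeasurableSet[history n] (Prod.mk ξ ⁻¹' s) :=
    @measurable_prodMk_left _ _ _ (history n) ξ s hs
  rw [lintegral_mul_mass_succ η ξ n (measurable_const.indicator hslice), hξ n, mul_one]

theorem integrable_mass
    (h_ident : ∀ n : ℕ, IdentDistrib (fun ξ : ℕ → Θ => ξ n) (fun ξ : ℕ → Θ => ξ 0) τ τ)
    (h_mean : ∀ᵐ ξ ∂τ, m η 0 1 ξ = 1) (n : ℕ) :
    Integrable (fun ω : (ℕ → Θ) × Marks => (mass n ω.2).toReal) (annealed τ η) :=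
  integrable_toReal_of_lintegral_ne_top (measurable_mass_snd n).aemeasurable
    (by rw [lintegral_mass_annealed η h_ident h_mean]; simp)

theorem martingale_mass
    (h_ident : ∀ n : ℕ, IdentDistrib (fun ξ : ℕ → Θ => ξ n) (fun ξ : ℕ → Θ => ξ 0) τ τ)
    (h_mean : ∀ᵐ ξ ∂τ, m η 0 1 ξ = 1) :
    Martingale (fun n (ω : (ℕ → Θ) × Marks) => (mass n ω.2).toReal) (past Θ) (annealed τ η) := by
  refine martingale_of_setIntegral_eq_succ (fun n => ?_) (integrable_mass η h_ident h_mean)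
    fun n s hs => ?_
  · refine Measurable.stronglyMeasurable ?_
    refine ENNReal.measurable_toReal.comp ((measurable_history_mass n).comp ?_)
    exact @measurable_snd _ _ _ (history n)
  · rw [integral_toReal (measurable_mass_snd n).aemeasurable
        (ae_of_all _ fun ω => (mass_ne_top n _).lt_top),
      integral_toReal (measurable_mass_snd (n + 1)).aemeasurable
        (ae_of_all _ fun ω => (mass_ne_top (n + 1) _).lt_top),
      setLIntegral_mass_succ η h_ident h_mean n hs]

end Martingale

/-! ### Transfer from `mass` to `W` and the two implications -/

section Main

variable {Θ : Type*} [MeasurableSpace Θ] {τ : Measure (ℕ → Θ)} [IsProbabilityMeasure τ]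
  (η : Kernel Θ Mark) [IsMarkovKernel η]

theorem ae_W_eq
    (h_ident : ∀ n : ℕ, IdentDistrib (fun ξ : ℕ → Θ => ξ n) (fun ξ : ℕ → Θ => ξ 0) τ τ)
    (h_mean : ∀ᵐ ξ ∂τ, m η 0 1 ξ = 1) :
    ∀ᵐ ω ∂(annealed τ η), ∀ n, W η n ω = (mass n ω.2).toReal := by
  have hfst : (annealed τ η).map Prod.fst = τ := Measure.fst_compProd τ (quenched η)
  have hgood : ∀ᵐ ω ∂(annealed τ η), ∀ n, m η n 1 ω.1 = 1 := by
    refine ae_of_ae_map (f := Prod.fst) (p := fun ξ => ∀ n, m η n 1 ξ = 1)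
      measurable_fst.aemeasurable ?_
    rw [hfst]
    exact ae_m_eq_one η h_ident h_mean
  filter_upwards [hgood] with ω hω n
  rw [W, Wt, P_eq_one η hω, partitionFn_one_eq, ENNReal.toReal_one, div_one]

theorem eLpNorm_mass {p : ℝ} (hp : 1 < p) (n : ℕ) :
    eLpNorm (fun ω : (ℕ → Θ) × Marks => (mass n ω.2).toReal) (ENNReal.ofReal p) (annealed τ η) =
      annealedMoment τ η p n ^ (1 / p) := by
  have hp0 : 0 < p := by linarith
  rw [eLpNorm_eq_lintegral_rpow_enorm_toReal (by simpa using hp0) ENNReal.ofReal_ne_top,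
    ENNReal.toReal_ofReal hp0.le, ← lintegral_mass_rpow_annealed]
  congr 1
  refine lintegral_congr fun ω => ?_
  rw [Real.enorm_of_nonneg ENNReal.toReal_nonneg, ENNReal.ofReal_toReal (mass_ne_top n _)]

/-- The mass is a nonnegative martingale, so its `L^1` norm is constantly `1` and Doob's convergence
theorem applies. -/
theorem ae_tendsto_W
    (h_ident : ∀ n : ℕ, IdentDistrib (fun ξ : ℕ → Θ => ξ n) (fun ξ : ℕ → Θ => ξ 0) τ τ)
    (h_mean : ∀ᵐ ξ ∂τ, m η 0 1 ξ = 1) :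
    ∀ᵐ ω ∂(annealed τ η), Tendsto (fun n => W η n ω) atTop (𝓝 (Wlim η ω)) := by
  have hbdd : ∀ n, eLpNorm (fun ω : (ℕ → Θ) × Marks => (mass n ω.2).toReal) 1 (annealed τ η) ≤
      ((1 : NNReal) : ℝ≥0∞) := fun n => by
    rw [eLpNorm_one_eq_lintegral_enorm, ENNReal.coe_one,
      ← lintegral_mass_annealed η h_ident h_mean n]
    refine (lintegral_congr fun ω => ?_).le
    rw [Real.enorm_of_nonneg ENNReal.toReal_nonneg, ENNReal.ofReal_toReal (mass_ne_top n _)]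
  filter_upwards [(martingale_mass η h_ident h_mean).submartingale.exists_ae_tendsto_of_bdd hbdd,
    ae_W_eq η h_ident h_mean] with ω ⟨c, hc⟩ hω
  exact tendsto_nhds_limUnder ⟨c, by simpa only [hω] using hc⟩

theorem lintegral_W_one_rpow
    (h_ident : ∀ n : ℕ, IdentDistrib (fun ξ : ℕ → Θ => ξ n) (fun ξ : ℕ → Θ => ξ 0) τ τ)
    (h_mean : ∀ᵐ ξ ∂τ, m η 0 1 ξ = 1) {p : ℝ} (hp : 1 < p) :
    ∫⁻ ω, ENNReal.ofReal (W η 1 ω ^ p) ∂(annealed τ η) = annealedMoment τ η p 1 := by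
  rw [← lintegral_mass_rpow_annealed]
  refine lintegral_congr_ae ?_
  filter_upwards [ae_W_eq η h_ident h_mean] with ω hω
  rw [hω, ← ENNReal.ofReal_rpow_of_nonneg ENNReal.toReal_nonneg (by linarith),
    ENNReal.ofReal_toReal (mass_ne_top 1 _)]

theorem convergesInLp_of_moment_lt (h_indep : iIndepFun (fun (n : ℕ) (ξ : ℕ → Θ) => ξ n) τ)
    (h_ident : ∀ n : ℕ, IdentDistrib (fun ξ : ℕ → Θ => ξ n) (fun ξ : ℕ → Θ => ξ 0) τ τ)
    (h_mean : ∀ᵐ ξ ∂τ, m η 0 1 ξ = 1) {p : ℝ} (hp : 1 < p) (hV : annealedMoment τ η p 1 ≠ ∞)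
    (hb : ∫⁻ ξ, m η 0 p ξ ∂τ < 1) : ConvergesInLp (annealed τ η) p (W η) (Wlim η) := by
  have hp0 : 0 < p := by linarith
  obtain ⟨B, hB, hbd⟩ := annealedMoment_bounded η h_indep h_ident h_mean hp hV hb
  have hW := ae_W_eq η h_ident h_mean
  have hWn : ∀ n, W η n =ᵐ[annealed τ η] fun ω => (mass n ω.2).toReal := fun n =>
    hW.mono fun ω hω => hω n
  have hR : B ^ (1 / p) ≠ ∞ := ENNReal.rpow_ne_top_of_nonneg (by positivity) hB
  have hle : ∀ n, eLpNorm (fun ω : (ℕ → Θ) × Marks => (mass n ω.2).toReal) (ENNReal.ofReal p)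
      (annealed τ η) ≤ B ^ (1 / p) := fun n => by
    rw [eLpNorm_mass η hp]
    exact ENNReal.rpow_le_rpow (hbd n) (by positivity)
  have hlim : ∀ᵐ ω ∂(annealed τ η),
      Tendsto (fun n => (mass n ω.2).toReal) atTop (𝓝 (Wlim η ω)) := by
    filter_upwards [ae_tendsto_W η h_ident h_mean, hW] with ω h1 h2
    simpa only [h2] using h1
  obtain ⟨h1, h2⟩ := tendsto_eLpNorm_of_martingale_bounded hp (martingale_mass η h_ident h_mean)
    hR hle hlim
  refine ⟨fun n => ?_, h1, ?_⟩
  · refine (memLp_congr_ae (hWn n)).2 ⟨?_, (hle n).trans_lt hR.lt_top⟩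
    exact (measurable_mass_snd n).ennreal_toReal.aestronglyMeasurable
  · refine h2.congr fun n => eLpNorm_congr_ae ?_
    filter_upwards [hWn n] with ω hω
    rw [Pi.sub_apply, hω]

theorem annealedMoment_bounded_of_convergesInLp
    (h_ident : ∀ n : ℕ, IdentDistrib (fun ξ : ℕ → Θ => ξ n) (fun ξ : ℕ → Θ => ξ 0) τ τ)
    (h_mean : ∀ᵐ ξ ∂τ, m η 0 1 ξ = 1) {p : ℝ} (hp : 1 < p)
    (h : ConvergesInLp (annealed τ η) p (W η) (Wlim η)) :
    ∃ B : ℝ≥0∞, B ≠ ∞ ∧ ∀ n, annealedMoment τ η p n ≤ B := by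
  have hp0 : 0 < p := by linarith
  obtain ⟨h1, h2, h3⟩ := h
  have h1p : 1 ≤ ENNReal.ofReal p := ENNReal.one_le_ofReal.2 hp.le
  have hmom : ∀ n, annealedMoment τ η p n = eLpNorm (W η n) (ENNReal.ofReal p) (annealed τ η) ^ p := by
    intro n
    have hWn : W η n =ᵐ[annealed τ η] fun ω => (mass n ω.2).toReal :=
      (ae_W_eq η h_ident h_mean).mono fun ω hω => hω n
    rw [eLpNorm_congr_ae hWn, eLpNorm_mass η hp, ← ENNReal.rpow_mul, one_div_mul_cancel hp0.ne',
      ENNReal.rpow_one]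
  have hfin : ∀ n, eLpNorm (W η n) (ENNReal.ofReal p) (annealed τ η) ≠ ∞ := fun n =>
    (h1 n).eLpNorm_ne_top
  obtain ⟨N, hN⟩ := eventually_atTop.1 (h3.eventually (gt_mem_nhds zero_lt_one))
  set g := eLpNorm (Wlim η) (ENNReal.ofReal p) (annealed τ η) with hg
  -- From `N` on, the triangle inequality bounds the norm by `1 + g`; the finitely many earlier
  -- norms are finite and are simply added.
  set A := (1 + g) + ∑ k ∈ Finset.range N, eLpNorm (W η k) (ENNReal.ofReal p) (annealed τ η) with hA
  have hAt : A ≠ ∞ := by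
    refine ENNReal.add_ne_top.2 ⟨ENNReal.add_ne_top.2 ⟨ENNReal.one_ne_top, h2.eLpNorm_ne_top⟩, ?_⟩
    exact ENNReal.sum_ne_top.2 fun k _ => hfin k
  refine ⟨A ^ p, ENNReal.rpow_ne_top_of_nonneg hp0.le hAt, fun n => ?_⟩
  rw [hmom]
  refine ENNReal.rpow_le_rpow ?_ hp0.le
  rcases lt_or_ge n N with hn | hn
  · exact (Finset.single_le_sum (f := fun k => eLpNorm (W η k) (ENNReal.ofReal p) (annealed τ η))
      (fun k _ => zero_le) (Finset.mem_range.2 hn)).trans le_add_self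
  · refine le_trans ?_ le_self_add
    have hsum : W η n = (fun ω => W η n ω - Wlim η ω) + Wlim η := by
      funext ω
      simp
    calc eLpNorm (W η n) (ENNReal.ofReal p) (annealed τ η)
        ≤ eLpNorm (fun ω => W η n ω - Wlim η ω) (ENNReal.ofReal p) (annealed τ η) + g := by
          conv_lhs => rw [hsum]
          exact eLpNorm_add_le ((h1 n).sub h2).aestronglyMeasurable h2.aestronglyMeasurable h1p
      _ ≤ 1 + g := by
          gcongr
          exact (hN n hn).le

end Main

end BRWRE

theorem mainTheorem2 {Θ : Type*} [MeasurableSpace Θ]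
    (τ : Measure (ℕ → Θ)) [IsProbabilityMeasure τ]
    (η : Kernel Θ BRWRE.Mark) [IsMarkovKernel η]
    (h_indep : iIndepFun (fun (n : ℕ) (ξ : ℕ → Θ) => ξ n) τ)
    (h_ident : ∀ n : ℕ, IdentDistrib (fun ξ : ℕ → Θ => ξ n) (fun ξ : ℕ → Θ => ξ 0) τ τ)
    (h_mean : ∀ᵐ ξ ∂τ, BRWRE.m η 0 1 ξ = 1)
    (h_nontrivial : BRWRE.annealed τ η {ω | BRWRE.W η 1 ω = 1} < 1)
    (p : ℝ) (hp : 1 < p) :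
    (∀ᵐ ω ∂(BRWRE.annealed τ η),
      Tendsto (fun n => BRWRE.W η n ω) atTop (𝓝 (BRWRE.Wlim η ω))) ∧
    (BRWRE.ConvergesInLp (BRWRE.annealed τ η) p (BRWRE.W η) (BRWRE.Wlim η) ↔
      (∫⁻ ω, ENNReal.ofReal (BRWRE.W η 1 ω ^ p) ∂(BRWRE.annealed τ η) < ∞ ∧
        ∫⁻ ξ, BRWRE.m η 0 p ξ ∂τ < 1)) := by
  refine ⟨BRWRE.ae_tendsto_W η h_ident h_mean, ?_⟩
  rw [BRWRE.lintegral_W_one_rpow η h_ident h_mean hp]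
  refine ⟨fun h => ?_, fun ⟨h1, h2⟩ =>
    BRWRE.convergesInLp_of_moment_lt η h_indep h_ident h_mean hp h1.ne h2⟩
  obtain ⟨B, hB, hbd⟩ := BRWRE.annealedMoment_bounded_of_convergesInLp η h_ident h_mean hp h
  refine ⟨(hbd 1).trans_lt hB.lt_top,
    BRWRE.lintegral_m_lt_one_of_bounded η h_indep h_ident h_mean hp hB hbd fun hone => ?_⟩
  have hW : ∀ᵐ ω ∂(BRWRE.annealed τ η), BRWRE.W η 1 ω = 1 := by
    filter_upwards [hone, BRWRE.ae_W_eq η h_ident h_mean] with ω h1 h2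
    rw [h2, h1, ENNReal.toReal_one]
  have huniv : BRWRE.annealed τ η {ω | BRWRE.W η 1 ω = 1} = BRWRE.annealed τ η Set.univ :=
    measure_congr (eventuallyEq_univ.2 hW)
  rw [huniv, measure_univ] at h_nontrivial
  exact lt_irrefl _ h_nontrivial
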